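/- Let $k\ge 3$ be an integer. For $\alpha\in\mathbb R$ put $$\Omega(t,\alpha,k)=t+\alpha\log_2\Big(1-\frac{k}{2^k}t^{k-1}+\frac{k-1}{2^k}t^k\Big),\qquad \omega_C(\alpha,k)=\max_{t\in[0,1]}\Omega(t,\alpha,k).$$ A random $k$-SAT instance with $N$ variables and $M$ clauses is a uniformly random set of $M$ distinct clauses, a clause being a disjunction of $k$ distinct literals over $N$ Boolean variables, no two of them complementary. The decision procedure DPLL-UC works on an instance $\mathcal F$ as follows, starting from the empty partial assignment $A$; $\mathcal F_A$ is what is left of $\mathcal F$ when the clauses satisfied by $A$ are removed and the literals falsified by $A$ are removed from the other clauses. (1) If $\mathcal F_A$ is empty, it outputs "satisfiable" and the whole procedure halts (solution leaf). (2) If $\mathcal F_A$ contains the empty clause, the call returns (contradiction leaf). (3) Otherwise, if $\mathcal F_A$ contains clauses with a single literal, it picks any one of them (by an arbitrary, possibly randomized, rule depending on $\mathcal F$ and $A$), say $\ell$, and calls itself with $A\cup\{\ell\}$ (unit propagation); if there is no such clause, it picks a literal $\ell$ uniformly at random among the literals of the unset variables, and calls itself with $A\cup\{\ell\}$ and then,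 unless it has halted, with $A\cup\{\bar\ell\}$ (splitting). The search tree consists of the calls that are made; its size may be taken to be its number of leaves or its number of nodes. The equation $\omega_C(\alpha,k)=2+\alpha\log_2(1-2^{-k})$ has exactly one real root $\alpha=\alpha_u(k)$; it is positive, and $\alpha_u(3)=10.1286\ldots$ For every $\alpha>\alpha_u(k)$ and every choice of the rules for picking unit clauses (one for each $N$), the expected size of the DPLL-UC search tree of a random $k$-SAT instance with $N$ variables and $M=\lfloor\alpha N\rfloor$ clauses (the expectation is over the instance and the random choices of the procedure) is $$2^{\,N\omega_C(\alpha,k)+o(N)}\qquad (N\to\infty),$$ both for the number of leaves and for the number of nodes. -/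

import Mathlib

open Filter Asymptotics
open scoped ENNReal

namespace RandomSat

/-- A literal over the Boolean variables `0, …, N - 1`: the pair `(x, b)` is the assertion
that the variable `x` has the truth value `b`. -/
abbrev Literal (N : ℕ) := Fin N × Bool

/-- The complementary literal. -/
def Literal.neg {N : ℕ} (l : Literal N) : Literal N := (l.1, !l.2)

/-- A clause is (the disjunction of) a finite set of literals. -/
abbrev Clause (N : ℕ) := Finset (Literal N)

/-- A formula (instance) is (the conjunction of) a finite set of clauses. -/
abbrev Formula (N : ℕ) := Finset (Clause N)

/-- All disjunctions of `k` distinct literals without complementary literals. -/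
def kClauses (N k : ℕ) : Finset (Clause N) :=
  Finset.univ.filter fun c => c.card = k ∧ ∀ l ∈ c, Literal.neg l ∉ c

/-- The possible random `k`-SAT instances: all sets of `M` clauses. -/
def instances (N k M : ℕ) : Finset (Formula N) :=
  (kClauses N k).powersetCard M

/-- A partial assignment: `none` means that the variable is unset. -/
abbrev PartialAssignment (N : ℕ) := Fin N → Option Bool

/-- The assignment `A ∪ {l}`: the literal `l` is made true. -/
def PartialAssignment.assign {N : ℕ} (A : PartialAssignment N) (l : Literal N) :
    PartialAssignment N :=
  Function.update A l.1 (some l.2)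

/-- The residual instance `F_A`: the clauses satisfied by `A` are removed, and in the other
clauses the literals falsified by `A` are removed, so that only unset literals are left. -/
def residual {N : ℕ} (F : Formula N) (A : PartialAssignment N) : Formula N :=
  (F.filter fun c => ∀ l ∈ c, A l.1 ≠ some l.2).image
    fun c => c.filter fun l => A l.1 = none

/-- The part of a search tree that has been explored. A node has one explored child after
unit propagation, and also after a splitting whose second branch is not explored because the
procedure has halted in the first one; it carries the literal set to true in the (first) child. -/
inductive SearchTree (N : ℕ) : Type
  | solution : SearchTree N
  | contradiction : SearchTree N
  | one (l : Literal N) (t : SearchTree N) : SearchTree N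
  | two (l : Literal N) (t₁ t₂ : SearchTree N) : SearchTree N

namespace SearchTree

/-- Number of leaves (solution leaves and contradiction leaves). -/
def leaves {N : ℕ} : SearchTree N → ℕ
  | solution => 1
  | contradiction => 1
  | one _ t => t.leaves
  | two _ t₁ t₂ => t₁.leaves + t₂.leaves

/-- Number of nodes, leaves included. -/
def nodes {N : ℕ} : SearchTree N → ℕ
  | solution => 1
  | contradiction => 1
  | one _ t => t.nodes + 1
  | two _ t₁ t₂ => t₁.nodes + t₂.nodes + 1

/-- Whether a solution leaf has been reached. -/
def sat {N : ℕ} : SearchTree N → Bool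
  | solution => true
  | contradiction => false
  | one _ t => t.sat
  | two _ t₁ t₂ => t₁.sat || t₂.sat

end SearchTree

/-- A rule for "pick any 1-clause": given the instance and the current partial assignment, a
(possibly random) choice of one of the 1-clauses `{l}` of the residual instance. -/
abbrev UnitRule (N : ℕ) :=
  ∀ (F : Formula N) (A : PartialAssignment N), (∃ l, ({l} : Clause N) ∈ residual F A) →
    PMF {l : Literal N // ({l} : Clause N) ∈ residual F A}

/-- The set of unset variables. -/
def PartialAssignment.unset {N : ℕ} (A : PartialAssignment N) : Finset (Fin N) :=
  Finset.univ.filter fun x => A x = none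

theorem card_unset_assign_lt {N : ℕ} {A : PartialAssignment N} {l : Literal N}
    (h : A l.1 = none) : (A.assign l).unset.card < A.unset.card := by
  have hmem : ∀ (B : PartialAssignment N) (x : Fin N), x ∈ B.unset ↔ B x = none := by
    intro B x
    simp [PartialAssignment.unset]
  apply Finset.card_lt_card
  rw [Finset.ssubset_iff_of_subset]
  · refine ⟨l.1, (hmem _ _).2 h, fun hx => ?_⟩
    have hx' := (hmem _ _).1 hx
    simp [PartialAssignment.assign] at hx'
  · intro x hx
    have hx' := (hmem _ _).1 hx
    by_cases hxl : x = l.1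
    · subst hxl
      exact (hmem _ _).2 h
    · exact (hmem _ _).2 (by simpa [PartialAssignment.assign, hxl] using hx')

theorem eq_none_of_mem_residual {N : ℕ} {F : Formula N} {A : PartialAssignment N}
    {c : Clause N} (hc : c ∈ residual F A) {l : Literal N} (hl : l ∈ c) : A l.1 = none := by
  obtain ⟨d, -, rfl⟩ := Finset.mem_image.mp hc
  exact (Finset.mem_filter.mp hl).2

theorem exists_unset_literal {N : ℕ} {F : Formula N} {A : PartialAssignment N}
    (h₁ : residual F A ≠ ∅) (h₂ : ∅ ∉ residual F A) :
    Nonempty {l : Literal N // A l.1 = none} := by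
  obtain ⟨c, hc⟩ := Finset.nonempty_iff_ne_empty.mpr h₁
  have hne : c.Nonempty := Finset.nonempty_iff_ne_empty.mpr fun h => h₂ (h ▸ hc)
  obtain ⟨l, hl⟩ := hne
  exact ⟨⟨l, eq_none_of_mem_residual hc hl⟩⟩

/-- The decision procedure DPLL-UC, as the probability law of the search tree that is explored
when it is called on the instance `F` with the partial assignment `A`. -/
noncomputable def dpllUC {N : ℕ} (rule : UnitRule N) (F : Formula N)
    (A : PartialAssignment N) : PMF (SearchTree N) :=
  if h₁ : residual F A = ∅ then
    -- solution leaf: output "satisfiable" and halt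
    PMF.pure SearchTree.solution
  else if h₂ : ∅ ∈ residual F A then
    -- contradiction leaf
    PMF.pure SearchTree.contradiction
  else if h₃ : ∃ l, ({l} : Clause N) ∈ residual F A then
    -- unit propagation
    (rule F A h₃).bind fun l =>
      (dpllUC rule F (A.assign l.1)).map (SearchTree.one l.1)
  else
    -- splitting on a uniformly random unset literal; the second branch is explored only
    -- when the procedure has not halted in the first one
    haveI : Nonempty {l : Literal N // A l.1 = none} := exists_unset_literal h₁ h₂
    (PMF.uniformOfFintype {l : Literal N // A l.1 = none}).bind fun l =>
      (dpllUC rule F (A.assign l.1)).bind fun t₁ =>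
        if t₁.sat then PMF.pure (SearchTree.one l.1 t₁)
        else (dpllUC rule F (A.assign l.1.neg)).map (SearchTree.two l.1 t₁)
termination_by A.unset.card
decreasing_by
  · exact card_unset_assign_lt (eq_none_of_mem_residual l.2 (Finset.mem_singleton_self _))
  · exact card_unset_assign_lt l.2
  · exact card_unset_assign_lt (l := l.1.neg) l.2

/-- Expectation of the statistic `f` of the DPLL-UC search tree of the fixed instance `F`
(over the random choices of the procedure, started from the empty assignment). -/
noncomputable def expectOn {N : ℕ} (rule : UnitRule N) (f : SearchTree N → ℕ)
    (F : Formula N) : ℝ≥0∞ :=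
  ∑' t : SearchTree N, dpllUC rule F (fun _ => none) t * (f t : ℝ≥0∞)

/-- Expectation of the statistic `f` of the DPLL-UC search tree of a random `k`-SAT instance
with `N` variables and `M` clauses. -/
noncomputable def expectRandom {N : ℕ} (rule : UnitRule N) (f : SearchTree N → ℕ)
    (k M : ℕ) : ℝ :=
  (∑ F ∈ instances N k M, (expectOn rule f F).toReal) / ((instances N k M).card : ℝ)

/-- `Ω(t, α, k) = t + α log₂ (1 - (k / 2^k) t^(k-1) + ((k-1) / 2^k) t^k)`. -/
noncomputable def Omega (t α : ℝ) (k : ℕ) : ℝ :=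
  t + α * Real.logb 2
    (1 - (k : ℝ) / 2 ^ k * t ^ (k - 1) + ((k : ℝ) - 1) / 2 ^ k * t ^ k)

/-- `ω_C(α, k)`, the maximum of `Ω(t, α, k)` over `t ∈ [0, 1]`. -/
noncomputable def omegaC (α : ℝ) (k : ℕ) : ℝ :=
  sSup ((fun t => Omega t α k) '' Set.Icc 0 1)

end RandomSat

/-!
The expected size is squeezed, up to subexponential factors, between two copies of the same exactly
computable quantity.

Give a node of the search tree the weight `0` if an empty clause is present, and `2 ^ (-u)` if there
are `u` unit clauses and no empty clause. For `M` independent random clauses and a fixed rule for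
unit clauses, the expected sum of the weights at depth `T` can be computed exactly
(`sum_levelWeight`): it is `2 ^ T` times the `M`-th power of the mean weight of one clause. Indeed,
the literal of a unit clause is uniformly distributed over the literals of the `n` unset variables.
When it is set to true, its own factor `1/2` is replaced by `1`, a gain of a factor `2`; any other
unit clause keeps the mean weight `1/2` (it disappears, becomes empty, or stays, with probabilities
`1/(2n)`, `1/(2n)` and `1 - 1/n`), and the longer clauses see a uniformly random literal. A splitting
contributes a factor `2` from its two branches. So both kinds of step act on the weights in the same
way. The mean weight of a clause after a fraction `t` of the variables has been set tends to
`1 - (k / 2 ^ k) t ^ (k - 1) + ((k - 1) / 2 ^ k) t ^ k`, so level `t N` has exponent `Ω(t, α, k)`.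

*Upper bound.* The number of leaves exceeds the number of splittings by one, and a node where a
splitting occurs has weight `1` (`leafCount_le`).

*Lower bound.* In the tree of an unsatisfiable instance every node has a leaf below it, and weights
are at most `1`, so each level bounds the number of leaves from below
(`levelWeight_le_leafCount`). Satisfiable instances contribute at most `2 ^ T` times their
probability, hence at most `2 ^ (N (2 + α log₂ (1 - 2⁻ᵏ)))` up to a constant by the first moment
bound (`sum_levelWeight_not_unsat`). The threshold is the value of `α` above which this is
negligible.

The passage from DPLL-UC with an arbitrary rule to the fixed one rests on the confluence of unit
propagation (`leafCount_succ_of_unit`, `expect_leaves_dpllUC`). The passage from independent clauses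
to sets of distinct clauses rests on the fact that repeating a clause cannot increase the weights
(`levelWeight_le_update_none`), so that tuples with repetitions are negligible for `k ≥ 3`
(`sum_levelWeight_not_injective`). Number of nodes and number of leaves differ by a factor of at
most `N + 1`.

As a function of `α`, the difference between `omegaC α k` and `2 + α log₂ (1 - 2⁻ᵏ)` is a maximum of
affine functions; it is negative at `0`, continuous, and positive to the right of any of its zeros,
which gives the threshold and its uniqueness.
-/

namespace RandomSat

open scoped NNReal

/-! ### Clauses and their residuals -/

/-- The `j`-clauses over the set of variables `V`. -/
def clausesOn {N : ℕ} (V : Finset (Fin N)) (j : ℕ) : Finset (Clause N) :=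
  Finset.univ.filter fun c =>
    c.card = j ∧ (∀ l ∈ c, l.1 ∈ V) ∧ ∀ l ∈ c, Literal.neg l ∉ c

theorem mem_clausesOn {N : ℕ} {V : Finset (Fin N)} {j : ℕ} {c : Clause N} :
    c ∈ clausesOn V j ↔
      c.card = j ∧ (∀ l ∈ c, l.1 ∈ V) ∧ ∀ l ∈ c, Literal.neg l ∉ c := by
  simp [clausesOn]

theorem clausesOn_univ (N k : ℕ) : clausesOn (Finset.univ : Finset (Fin N)) k = kClauses N k := by
  simp [clausesOn, kClauses]

theorem Literal.neg_neg {N : ℕ} (l : Literal N) : l.neg.neg = l := by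
  simp [Literal.neg]

theorem Literal.neg_ne {N : ℕ} (l : Literal N) : l.neg ≠ l := by
  intro h
  have := congrArg Prod.snd h
  simp [Literal.neg] at this

theorem Literal.eq_or_eq_neg {N : ℕ} {l m : Literal N} (h : m.1 = l.1) : m = l ∨ m = l.neg := by
  obtain ⟨x, b⟩ := l
  obtain ⟨y, d⟩ := m
  simp only at h
  subst h
  cases b <;> cases d <;> simp [Literal.neg]

/-- What is left of the clause `c` when the literal `l` is set to true; `none` stands for a
satisfied clause. -/
def reduce {N : ℕ} (l : Literal N) (c : Clause N) : Option (Clause N) :=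
  if l ∈ c then none else some (c.erase l.neg)

theorem sum_clausesOn_of_mem {N : ℕ} {V : Finset (Fin N)} {l : Literal N} (hl : l.1 ∈ V) (j : ℕ)
    (g : Clause N → ℝ≥0) :
    ∑ c ∈ (clausesOn V (j + 1)).filter (l ∈ ·), g (c.erase l) =
      ∑ c ∈ clausesOn (V.erase l.1) j, g c := by
  refine Finset.sum_bij' (fun c _ => c.erase l) (fun c _ => insert l c) ?_ ?_ ?_ ?_ ?_
  · intro c hc
    rw [Finset.mem_filter, mem_clausesOn] at hc
    obtain ⟨⟨h1, h2, h3⟩, h4⟩ := hc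
    rw [mem_clausesOn]
    refine ⟨by rw [Finset.card_erase_of_mem h4, h1]; rfl, fun m hm => ?_, fun m hm => ?_⟩
    · rw [Finset.mem_erase] at hm ⊢
      refine ⟨fun h => ?_, h2 _ hm.2⟩
      rcases Literal.eq_or_eq_neg h with h | h
      · exact hm.1 h
      · exact h3 l h4 (h ▸ hm.2)
    · rw [Finset.mem_erase] at hm ⊢
      exact fun h => h3 m hm.2 h.2
  · intro c hc
    rw [mem_clausesOn] at hc
    obtain ⟨h1, h2, h3⟩ := hc
    have hlc : ∀ m : Literal N, m.1 = l.1 → m ∉ c := fun m hm h => by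
      have := h2 m h
      rw [hm] at this
      simp at this
    rw [Finset.mem_filter, mem_clausesOn]
    refine ⟨⟨by rw [Finset.card_insert_of_notMem (hlc l rfl), h1], fun m hm => ?_,
      fun m hm => ?_⟩, Finset.mem_insert_self _ _⟩
    · rw [Finset.mem_insert] at hm
      rcases hm with rfl | hm
      · exact hl
      · exact Finset.mem_of_mem_erase (h2 m hm)
    · rw [Finset.mem_insert] at hm ⊢
      rintro (h | h)
      · rcases hm with rfl | hm
        · exact Literal.neg_ne _ h
        · exact hlc m (by rw [← h]; rfl) hm
      · rcases hm with rfl | hm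
        · exact hlc m.neg rfl h
        · exact h3 m hm h
  · intro c hc
    exact Finset.insert_erase (Finset.mem_filter.1 hc).2
  · intro c hc
    rw [mem_clausesOn] at hc
    refine Finset.erase_insert fun h => ?_
    have := hc.2.1 l h
    simp at this
  · intro c hc
    rfl

theorem filter_clausesOn_of_notMem {N : ℕ} {V : Finset (Fin N)} (l : Literal N) (j : ℕ) :
    (clausesOn V j).filter (fun c => l ∉ c ∧ l.neg ∉ c) = clausesOn (V.erase l.1) j := by
  ext c
  rw [Finset.mem_filter, mem_clausesOn, mem_clausesOn]
  constructor
  · rintro ⟨⟨h1, h2, h3⟩, h4, h5⟩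
    refine ⟨h1, fun m hm => Finset.mem_erase.2 ⟨fun h => ?_, h2 m hm⟩, h3⟩
    rcases Literal.eq_or_eq_neg h with rfl | rfl
    · exact h4 hm
    · exact h5 hm
  · rintro ⟨h1, h2, h3⟩
    refine ⟨⟨h1, fun m hm => Finset.mem_of_mem_erase (h2 m hm), h3⟩, fun h => ?_, fun h => ?_⟩
    · simpa using h2 _ h
    · simpa [Literal.neg] using h2 _ h

/-- A `(j+1)`-clause either contains `l` and gets satisfied, or contains the complement of `l`
and loses a literal, or is untouched. -/
theorem sum_reduce_clausesOn {N : ℕ} {V : Finset (Fin N)} {l : Literal N} (hl : l.1 ∈ V) (j : ℕ)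
    (g : Option (Clause N) → ℝ≥0) :
    ∑ c ∈ clausesOn V (j + 1), g (reduce l c) =
      (clausesOn (V.erase l.1) j).card * g none +
        (∑ c ∈ clausesOn (V.erase l.1) j, g (some c) +
          ∑ c ∈ clausesOn (V.erase l.1) (j + 1), g (some c)) := by
  rw [← Finset.sum_filter_add_sum_filter_not _ (l ∈ ·)]
  congr 1
  · rw [← nsmul_eq_mul, ← Finset.sum_const, ← sum_clausesOn_of_mem hl j (fun _ => g none)]
    refine Finset.sum_congr rfl fun c hc => ?_
    rw [reduce, if_pos (Finset.mem_filter.1 hc).2]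
  · rw [← Finset.sum_filter_add_sum_filter_not _ (l.neg ∈ ·)]
    congr 1
    · have h1 := sum_clausesOn_of_mem (l := l.neg) hl j (fun c => g (some c))
      rw [show l.neg.1 = l.1 from rfl] at h1
      rw [← h1, Finset.filter_filter]
      refine Finset.sum_congr ?_ fun c hc => ?_
      · refine Finset.filter_congr fun c hc => ⟨fun h => h.2, fun h => ⟨fun h' => ?_, h⟩⟩
        exact (mem_clausesOn.1 hc).2.2 l h' h
      · have h3 := Finset.mem_filter.1 hc
        rw [reduce, if_neg]
        intro h
        exact (mem_clausesOn.1 h3.1).2.2 l h h3.2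
    · rw [Finset.filter_filter, filter_clausesOn_of_notMem]
      refine Finset.sum_congr rfl fun c hc => ?_
      have h := (mem_clausesOn.1 hc).2.1
      rw [reduce, if_neg (fun h' => by simpa using h _ h'), Finset.erase_eq_of_notMem]
      intro h'
      simpa [Literal.neg] using h _ h'

theorem clausesOn_zero {N : ℕ} (V : Finset (Fin N)) : clausesOn V 0 = {∅} := by
  ext c
  rw [mem_clausesOn, Finset.mem_singleton, Finset.card_eq_zero]
  constructor
  · exact fun h => h.1
  · rintro rfl
    simp

theorem card_clausesOn {N : ℕ} (V : Finset (Fin N)) (j : ℕ) :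
    (clausesOn V j).card = 2 ^ j * V.card.choose j := by
  induction V using Finset.induction_on generalizing j with
  | empty =>
    cases j with
    | zero => simp [clausesOn_zero]
    | succ j =>
      simp only [Finset.card_empty, Nat.choose_zero_succ, mul_zero, Finset.card_eq_zero]
      ext c
      rw [mem_clausesOn]
      constructor
      · rintro ⟨h1, h2, -⟩
        obtain ⟨l, hl⟩ : c.Nonempty := Finset.card_pos.1 (by omega)
        simpa using h2 l hl
      · simp
  | insert x V hx ih =>
    cases j with
    | zero => simp [clausesOn_zero]
    | succ j =>
      have h := sum_reduce_clausesOn (V := insert x V) (l := (x, true))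
        (Finset.mem_insert_self _ _) j (fun _ => 1)
      simp only [Finset.sum_const, nsmul_eq_mul, mul_one, Finset.erase_insert hx, ih] at h
      rw [Finset.card_insert_of_notMem hx, Nat.choose_succ_succ]
      have h2 : (clausesOn (insert x V) (j + 1)).card =
          2 ^ j * V.card.choose j + (2 ^ j * V.card.choose j +
            2 ^ (j + 1) * V.card.choose (j + 1)) := by exact_mod_cast h
      rw [h2]
      ring

/-- `clauseWeight T n j` is the total weight of the `j`-clauses over `n` variables after `T` of the
variables have been set in a fixed way: a clause has weight `0` if it is falsified, `1/2` if it has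
become a unit clause, and `1` otherwise. The total is an integer, because complementing the unset
literal pairs up the unit clauses. -/
def clauseWeight : ℕ → ℕ → ℕ → ℕ
  | 0, _, 0 => 0
  | 0, n, 1 => n
  | 0, n, j + 2 => 2 ^ (j + 2) * n.choose (j + 2)
  | _ + 1, _, 0 => 0
  | _ + 1, 0, _ + 1 => 0
  | T + 1, n + 1, j + 1 =>
    2 ^ j * n.choose j + (clauseWeight T n j + clauseWeight T n (j + 1))

theorem clauseWeight_zero_right (T n : ℕ) : clauseWeight T n 0 = 0 := by
  cases T <;> simp [clauseWeight]

theorem clauseWeight_one_right {T n : ℕ} (h : T ≤ n) : clauseWeight T n 1 = n := by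
  induction T generalizing n with
  | zero => simp [clauseWeight]
  | succ T ih =>
    obtain ⟨n, rfl⟩ : ∃ m, n = m + 1 := ⟨n - 1, by omega⟩
    simp [clauseWeight, clauseWeight_zero_right, ih (by omega : T ≤ n)]
    ring

/-- The weight that is missing: `1` for each of the falsified clauses, which are given by their
sets of variables, and `1/2` for each of the unit clauses, of which there are two for every choice
of the variables of the falsified literals and of the unset variable. -/
theorem clauseWeight_add {T n : ℕ} (h : T ≤ n) (j : ℕ) :
    clauseWeight T n (j + 1) + (T.choose (j + 1) + T.choose j * (n - T)) =
      2 ^ (j + 1) * n.choose (j + 1) := by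
  induction T generalizing n j with
  | zero =>
    cases j with
    | zero => simp [clauseWeight]; ring
    | succ j => simp [clauseWeight]
  | succ T ih =>
    obtain ⟨n, rfl⟩ : ∃ m, n = m + 1 := ⟨n - 1, by omega⟩
    have h1 := ih (by omega : T ≤ n) j
    have hs : n + 1 - (T + 1) = n - T := by omega
    cases j with
    | zero =>
      rw [clauseWeight_one_right h]
      simp only [zero_add, Nat.choose_one_right, Nat.choose_zero_right, one_mul, pow_one]
      omega
    | succ j =>
      have h2 := ih (by omega : T ≤ n) (j := j)
      rw [clauseWeight, hs, Nat.choose_succ_succ n, Nat.choose_succ_succ T,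
        Nat.choose_succ_succ T j]
      simp only [Nat.succ_eq_add_one]
      generalize n - T = d at *
      have h3 : 2 ^ (j + 1 + 1) * (n.choose (j + 1) + n.choose (j + 1 + 1)) =
          2 ^ (j + 1) * n.choose (j + 1) + 2 ^ (j + 1) * n.choose (j + 1) +
            2 ^ (j + 1 + 1) * n.choose (j + 1 + 1) := by ring
      rw [h3, ← h1]
      nth_rewrite 3 [← h2]
      ring

/-- Setting the literal `l` to true in a tuple of clauses. -/
def cond {N M : ℕ} (l : Literal N) (c : Fin M → Option (Clause N)) : Fin M → Option (Clause N) :=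
  fun i => (c i).bind (reduce l)

/-- `l` is the literal of the unit clause of least index. -/
def IsFirstUnit {N M : ℕ} (c : Fin M → Option (Clause N)) (l : Literal N) : Prop :=
  ∃ i, c i = some {l} ∧ ∀ i' < i, ∀ l', c i' ≠ some {l'}

open Classical in
/-- The literal of the unit clause of least index, if there is a unit clause. -/
noncomputable def firstUnit {N M : ℕ} (c : Fin M → Option (Clause N)) : Option (Literal N) :=
  if h : ∃ l, IsFirstUnit c l then some h.choose else none

theorem IsFirstUnit.unique {N M : ℕ} {c : Fin M → Option (Clause N)} {l l' : Literal N}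
    (h : IsFirstUnit c l) (h' : IsFirstUnit c l') : l = l' := by
  obtain ⟨i, hi, hi'⟩ := h
  obtain ⟨j, hj, hj'⟩ := h'
  rcases lt_trichotomy i j with hij | hij | hij
  · exact absurd hi (hj' i hij l)
  · subst hij
    rw [hi] at hj
    simpa using hj
  · exact absurd hj (hi' j hij l')

theorem firstUnit_eq_some {N M : ℕ} {c : Fin M → Option (Clause N)} {l : Literal N} :
    firstUnit c = some l ↔ IsFirstUnit c l := by
  unfold firstUnit
  split_ifs with h
  · simp only [Option.some.injEq]
    exact ⟨fun h' => h' ▸ h.choose_spec, fun h' => h.choose_spec.unique h'⟩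
  · simp only [false_iff]
    exact fun h' => h ⟨l, h'⟩

theorem exists_isFirstUnit {N M : ℕ} {c : Fin M → Option (Clause N)}
    (h : ∃ i l, c i = some {l}) : ∃ l, IsFirstUnit c l := by
  obtain ⟨i, ⟨l, hl⟩, hmin⟩ :=
    (wellFounded_lt (α := Fin M)).has_min {i | ∃ l, c i = some {l}} h
  exact ⟨l, i, hl, fun i' hi' l' h' => hmin i' ⟨l', h'⟩ hi'⟩

/-- The weight of a residual clause: `0` for the empty clause, `1/2` for a unit clause. -/
noncomputable def weight {N : ℕ} : Option (Clause N) → ℝ≥0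
  | none => 1
  | some c => if c.card = 0 then 0 else if c.card = 1 then 1 / 2 else 1

open Classical in
/-- The expected sum of `2 ^ (- number of unit clauses)` over the nodes of depth `T` without
empty clause, in the search tree of the tuple of clauses `c` over the variables `V`, for the
procedure that never halts and propagates the unit clause of least index. -/
noncomputable def levelWeight {N M : ℕ} :
    ℕ → Finset (Fin N) → (Fin M → Option (Clause N)) → ℝ≥0
  | 0, _, c => ∏ i, weight (c i)
  | T + 1, V, c =>
    if ∃ i, c i = some ∅ then 0
    else match firstUnit c with
      | some l => levelWeight T (V.erase l.1) (cond l c)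
      | none => (V.card : ℝ≥0)⁻¹ *
          ∑ l ∈ V ×ˢ (Finset.univ : Finset Bool), levelWeight T (V.erase l.1) (cond l c)

/-! ### The exact computation of the weight of a level -/

/-- Independent transformations of the coordinates: if the image of `S i` under `r` is, with
multiplicities, a combination of the sets `R τ`, and if the sum of `H` over each product of sets
`R τ` factorizes, then so does the sum of `H` over the image of the product of the sets `S i`. -/
theorem sum_piFinset_comp {ι α β κ : Type*} [Fintype ι] [DecidableEq ι] [Fintype β]
    [DecidableEq β] (S : ι → Finset α) (r : α → β) (K : ι → Finset κ) (m : ι → κ → ℝ≥0)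
    (R : κ → Finset β)
    (hr : ∀ i (g : β → ℝ≥0), ∑ a ∈ S i, g (r a) = ∑ τ ∈ K i, m i τ * ∑ b ∈ R τ, g b)
    (H : (ι → β) → ℝ≥0) (C : ℝ≥0) (ω : κ → ℝ≥0)
    (hH : ∀ τ : ι → κ, ∑ b ∈ Fintype.piFinset (fun i => R (τ i)), H b = C * ∏ i, ω (τ i)) :
    ∑ a ∈ Fintype.piFinset S, H (fun i => r (a i)) = C * ∏ i, ∑ τ ∈ K i, m i τ * ω τ := by
  classical
  have hexp : ∀ y : ι → β, H y = ∑ b : ι → β, H b * ∏ i, if y i = b i then 1 else 0 := by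
    intro y
    rw [Finset.sum_eq_single y]
    · simp
    · intro b _ hb
      rw [Finset.prod_boole, if_neg, mul_zero]
      exact fun h => hb (funext fun i => (h i (Finset.mem_univ i)).symm)
    · simp
  have h1 : ∀ τ : ι → κ, ∑ y ∈ Fintype.piFinset (fun i => R (τ i)), H y =
      ∑ b : ι → β, H b * ∏ i, ∑ y ∈ R (τ i), if y = b i then 1 else 0 := by
    intro τ
    rw [Finset.sum_congr rfl fun y _ => hexp y, Finset.sum_comm]
    refine Finset.sum_congr rfl fun b _ => ?_
    rw [← Finset.mul_sum, Finset.prod_univ_sum]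
  calc ∑ a ∈ Fintype.piFinset S, H (fun i => r (a i))
      = ∑ b : ι → β, H b * ∏ i, ∑ a ∈ S i, if r a = b i then 1 else 0 := by
        rw [Finset.sum_congr rfl fun a _ => hexp fun i => r (a i), Finset.sum_comm]
        refine Finset.sum_congr rfl fun b _ => ?_
        rw [← Finset.mul_sum, Finset.prod_univ_sum]
    _ = ∑ b : ι → β, ∑ τ ∈ Fintype.piFinset K,
          (∏ i, m i (τ i)) * (H b * ∏ i, ∑ y ∈ R (τ i), if y = b i then 1 else 0) := by
        refine Finset.sum_congr rfl fun b _ => ?_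
        have : ∀ i, (∑ a ∈ S i, if r a = b i then (1 : ℝ≥0) else 0) =
            ∑ τ ∈ K i, m i τ * ∑ y ∈ R τ, if y = b i then 1 else 0 :=
          fun i => hr i fun y => if y = b i then 1 else 0
        rw [Finset.prod_congr rfl fun i _ => this i, Finset.prod_univ_sum, Finset.mul_sum]
        refine Finset.sum_congr rfl fun τ _ => ?_
        rw [Finset.prod_mul_distrib]
        ring
    _ = ∑ τ ∈ Fintype.piFinset K, (∏ i, m i (τ i)) * (C * ∏ i, ω (τ i)) := by
        rw [Finset.sum_comm]
        refine Finset.sum_congr rfl fun τ _ => ?_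
        rw [← Finset.mul_sum, ← h1, hH]
    _ = C * ∏ i, ∑ τ ∈ K i, m i τ * ω τ := by
        rw [Finset.prod_univ_sum, Finset.mul_sum]
        refine Finset.sum_congr rfl fun τ _ => ?_
        rw [Finset.prod_mul_distrib]
        ring

/-- The residual clauses over the variables `V` of a given length; `none` is the length of a
satisfied clause. -/
def clauseStates {N : ℕ} (V : Finset (Fin N)) : Option ℕ → Finset (Option (Clause N))
  | none => {none}
  | some j => (clausesOn V j).map Function.Embedding.some

/-- `clauseWeight`, with value `1` for a satisfied clause. -/
def stateWeight (T n : ℕ) : Option ℕ → ℝ≥0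
  | none => 1
  | some j => clauseWeight T n j

theorem sum_weight {N : ℕ} (V : Finset (Fin N)) (s : Option ℕ) :
    ∑ c ∈ clauseStates V s, weight c = stateWeight 0 V.card s := by
  cases s with
  | none => simp [clauseStates, weight, stateWeight]
  | some j =>
    rw [clauseStates, Finset.sum_map, stateWeight]
    have h : ∀ c ∈ clausesOn V j, weight (Function.Embedding.some c) =
        if j = 0 then 0 else if j = 1 then 1 / 2 else 1 := by
      intro c hc
      rw [Function.Embedding.some_apply, weight, (mem_clausesOn.1 hc).1]
    rw [Finset.sum_congr rfl h, Finset.sum_const, card_clausesOn, nsmul_eq_mul]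
    match j with
    | 0 => simp [clauseWeight]
    | 1 => simp [clauseWeight]; ring
    | j + 2 => simp [clauseWeight]

theorem stateWeight_zero (T n : ℕ) : stateWeight T n (some 0) = 0 := by
  simp [stateWeight, clauseWeight_zero_right]

/-- The lengths that a clause of a given length may have after one variable has been set. -/
def nextStates : Option ℕ → Finset (Option ℕ)
  | none => {none}
  | some 0 => {some 0}
  | some (j + 1) => {none, some j, some (j + 1)}

/-- The number of clauses of a given length, over `n + 1` variables, that become a given clause
when a literal is set to true. -/
def multiplicity (n : ℕ) : Option ℕ → Option ℕ → ℝ≥0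
  | some (j + 1), none => 2 ^ j * n.choose j
  | _, _ => 1

theorem sum_reduce_clauseStates {N : ℕ} {V : Finset (Fin N)} {l : Literal N} (hl : l.1 ∈ V)
    (s : Option ℕ) (g : Option (Clause N) → ℝ≥0) :
    ∑ c ∈ clauseStates V s, g (c.bind (reduce l)) =
      ∑ τ ∈ nextStates s, multiplicity (V.erase l.1).card s τ *
        ∑ c ∈ clauseStates (V.erase l.1) τ, g c := by
  match s with
  | none => simp [clauseStates, nextStates, multiplicity]
  | some 0 => simp [clauseStates, nextStates, multiplicity, clausesOn_zero, reduce]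
  | some (j + 1) =>
    have h := sum_reduce_clausesOn hl j g
    rw [card_clausesOn] at h
    rw [clauseStates, Finset.sum_map, nextStates, Finset.sum_insert (by simp),
      Finset.sum_insert (by simp), Finset.sum_singleton]
    simp only [Function.Embedding.some_apply, Option.bind_some, multiplicity, clauseStates,
      Finset.sum_singleton, Finset.sum_map, one_mul]
    rw [h]
    push_cast
    ring

theorem sum_nextStates (T n : ℕ) (s : Option ℕ) :
    ∑ τ ∈ nextStates s, multiplicity n s τ * stateWeight T n τ = stateWeight (T + 1) (n + 1) s := by
  match s with
  | none => simp [nextStates, multiplicity, stateWeight]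
  | some 0 => simp [nextStates, stateWeight, clauseWeight_zero_right]
  | some (j + 1) =>
    rw [nextStates, Finset.sum_insert (by simp), Finset.sum_insert (by simp),
      Finset.sum_singleton]
    simp [multiplicity, stateWeight, clauseWeight]

theorem mem_clauseStates_some {N : ℕ} {V : Finset (Fin N)} {j : ℕ} {o : Option (Clause N)} :
    o ∈ clauseStates V (some j) ↔ ∃ c ∈ clausesOn V j, o = some c := by
  simp [clauseStates, eq_comm]

theorem length_of_mem_clauseStates {N : ℕ} {V : Finset (Fin N)} {s : Option ℕ} {c : Clause N}
    (h : some c ∈ clauseStates V s) : s = some c.card ∧ c ∈ clausesOn V c.card := by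
  cases s with
  | none => simp [clauseStates] at h
  | some j =>
    obtain ⟨d, hd, h⟩ := mem_clauseStates_some.1 h
    obtain rfl : c = d := by simpa using h
    obtain rfl := (mem_clausesOn.1 hd).1
    exact ⟨rfl, hd⟩

theorem levelWeight_succ_of_empty {N M : ℕ} {T : ℕ} {V : Finset (Fin N)}
    {c : Fin M → Option (Clause N)} (h : ∃ i, c i = some ∅) : levelWeight (T + 1) V c = 0 := by
  rw [levelWeight, if_pos h]

theorem levelWeight_succ_of_unit {N M : ℕ} {T : ℕ} {V : Finset (Fin N)}
    {c : Fin M → Option (Clause N)} (h : ¬ ∃ i, c i = some ∅) {l : Literal N}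
    (hl : IsFirstUnit c l) :
    levelWeight (T + 1) V c = levelWeight T (V.erase l.1) (cond l c) := by
  rw [levelWeight, if_neg h, firstUnit_eq_some.2 hl]

theorem firstUnit_eq_none {N M : ℕ} {c : Fin M → Option (Clause N)} :
    firstUnit c = none ↔ ∀ i l, c i ≠ some {l} := by
  constructor
  · intro h i l hil
    obtain ⟨m, hm⟩ := exists_isFirstUnit ⟨i, l, hil⟩
    rw [firstUnit_eq_some.2 hm] at h
    simp at h
  · intro h
    by_contra h'
    obtain ⟨m, hm⟩ := Option.ne_none_iff_exists'.1 h'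
    obtain ⟨i, hi, -⟩ := firstUnit_eq_some.1 hm
    exact h i m hi

theorem levelWeight_succ_of_split {N M : ℕ} {T : ℕ} {V : Finset (Fin N)}
    {c : Fin M → Option (Clause N)} (h : ¬ ∃ i, c i = some ∅) (hl : ∀ i l, c i ≠ some {l}) :
    levelWeight (T + 1) V c = (V.card : ℝ≥0)⁻¹ *
      ∑ l ∈ V ×ˢ (Finset.univ : Finset Bool), levelWeight T (V.erase l.1) (cond l c) := by
  rw [levelWeight, if_neg h, firstUnit_eq_none.2 hl]

/-- The sum over independent clauses of given lengths over the variables `V` of the weight of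
level `T` is computed exactly. In each step a uniformly random literal of `V` is set to true, and a
factor `2` is gained: in unit propagation because the weight `1/2` of the unit clause is replaced
by `1`, in a splitting because both values of the variable are explored. -/
theorem sum_levelWeight {N M : ℕ} (T : ℕ) (V : Finset (Fin N)) (hT : T ≤ V.card)
    (s : Fin M → Option ℕ) :
    ∑ c ∈ Fintype.piFinset (fun i => clauseStates V (s i)), levelWeight T V c =
      2 ^ T * ∏ i, stateWeight T V.card (s i) := by
  induction T generalizing V s with
  | zero =>
    simp only [levelWeight, pow_zero, one_mul]
    rw [← Finset.prod_univ_sum]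
    exact Finset.prod_congr rfl fun i _ => sum_weight V (s i)
  | succ T ih =>
    have hcard : ∀ x ∈ V, V.card = (V.erase x).card + 1 := fun x hx =>
      (Finset.card_erase_add_one hx).symm
    by_cases h0 : ∃ i, s i = some 0
    · obtain ⟨i, hi⟩ := h0
      rw [Finset.prod_eq_zero (Finset.mem_univ i) (by rw [hi, stateWeight_zero]), mul_zero]
      refine Finset.sum_eq_zero fun c hc => levelWeight_succ_of_empty ⟨i, ?_⟩
      have := Fintype.mem_piFinset.1 hc i
      rw [hi, mem_clauseStates_some] at this
      obtain ⟨d, hd, hd'⟩ := this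
      rw [clausesOn_zero, Finset.mem_singleton] at hd
      rw [hd', hd]
    have hne : ∀ c ∈ Fintype.piFinset (fun i => clauseStates V (s i)), ¬ ∃ i, c i = some ∅ := by
      rintro c hc ⟨i, hi⟩
      have := Fintype.mem_piFinset.1 hc i
      rw [hi] at this
      exact h0 ⟨i, (length_of_mem_clauseStates this).1⟩
    by_cases h1 : ∃ i, s i = some 1
    · obtain ⟨i, hi, hmin⟩ := (wellFounded_lt (α := Fin M)).has_min {i | s i = some 1} h1
      have hmaps : ∀ c ∈ Fintype.piFinset (fun i => clauseStates V (s i)),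
          c i ∈ clauseStates V (some 1) := by
        intro c hc
        have := Fintype.mem_piFinset.1 hc i
        rwa [hi] at this
      have hsingle : ∀ o ∈ clauseStates V (some 1), ∃ l : Literal N, l.1 ∈ V ∧ o = some {l} := by
        intro o ho
        obtain ⟨d, hd, rfl⟩ := mem_clauseStates_some.1 ho
        obtain ⟨hd1, hd2, -⟩ := mem_clausesOn.1 hd
        obtain ⟨l, rfl⟩ := Finset.card_eq_one.1 hd1
        exact ⟨l, hd2 l (Finset.mem_singleton_self l), rfl⟩
      rw [← Finset.sum_fiberwise_of_maps_to hmaps]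
      have hfib : ∀ o ∈ clauseStates V (some 1),
          ∑ c ∈ (Fintype.piFinset (fun i => clauseStates V (s i))).filter (fun c => c i = o),
            levelWeight (T + 1) V c =
          2 ^ T * ∏ i' ∈ Finset.univ.erase i, stateWeight (T + 1) V.card (s i') := by
        intro o ho
        obtain ⟨l, hl, rfl⟩ := hsingle o ho
        have hfirst : ∀ c ∈ (Fintype.piFinset (fun i => clauseStates V (s i))).filter
            (fun c => c i = some {l}),
            levelWeight (T + 1) V c = levelWeight T (V.erase l.1) (cond l c) := by
          intro c hc
          obtain ⟨hc, hcl⟩ := Finset.mem_filter.1 hc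
          refine levelWeight_succ_of_unit (hne c hc) ⟨i, hcl, fun i' hi' l' h' => ?_⟩
          have := Fintype.mem_piFinset.1 hc i'
          rw [h'] at this
          exact hmin i' (by simpa using (length_of_mem_clauseStates this).1) hi'
        rw [Finset.sum_congr rfl hfirst,
          ← Fintype.piFinset_update_singleton_eq_filter_piFinset_eq (fun i => clauseStates V (s i))
            i (by rw [hi]; exact ho)]
        have hT' : T ≤ (V.erase l.1).card := by
          have := hcard _ hl
          omega
        have key := sum_piFinset_comp
          (Function.update (fun i => clauseStates V (s i)) i {some {l}})
          (fun o => o.bind (reduce l)) (Function.update (fun i' => nextStates (s i')) i {none})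
          (Function.update (fun i' => multiplicity (V.erase l.1).card (s i')) i (fun _ => 1))
          (clauseStates (V.erase l.1)) ?_ (levelWeight T (V.erase l.1)) (2 ^ T)
          (stateWeight T (V.erase l.1).card) (fun τ => ih _ hT' τ)
        · refine key.trans ?_
          congr 1
          rw [← Finset.mul_prod_erase _ _ (Finset.mem_univ i)]
          have hi1 : ∑ τ ∈ Function.update (fun i' => nextStates (s i')) i {none} i,
              Function.update (fun i' => multiplicity (V.erase l.1).card (s i')) i (fun _ => 1) i τ
                * stateWeight T (V.erase l.1).card τ = 1 := by
            simp [stateWeight]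
          rw [hi1, one_mul]
          refine Finset.prod_congr rfl fun i' hi' => ?_
          have hi'' := Finset.ne_of_mem_erase hi'
          rw [Function.update_of_ne hi'', Function.update_of_ne hi'', sum_nextStates,
            ← hcard _ hl]
        · intro i' g
          by_cases hi' : i' = i
          · subst hi'
            simp [reduce, clauseStates]
          · rw [Function.update_of_ne hi', Function.update_of_ne hi', Function.update_of_ne hi']
            exact sum_reduce_clauseStates hl (s i') g
      rw [Finset.sum_congr rfl hfib, Finset.sum_const, clauseStates, Finset.card_map,
        card_clausesOn, ← Finset.mul_prod_erase _ _ (Finset.mem_univ i), hi, stateWeight,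
        clauseWeight_one_right hT, nsmul_eq_mul]
      simp only [pow_one, Nat.choose_one_right]
      push_cast
      ring
    · have hsplit : ∀ c ∈ Fintype.piFinset (fun i => clauseStates V (s i)),
          levelWeight (T + 1) V c = (V.card : ℝ≥0)⁻¹ *
            ∑ l ∈ V ×ˢ (Finset.univ : Finset Bool), levelWeight T (V.erase l.1) (cond l c) := by
        intro c hc
        refine levelWeight_succ_of_split (hne c hc) fun i l hil => ?_
        have := Fintype.mem_piFinset.1 hc i
        rw [hil] at this
        exact h1 ⟨i, by simpa using (length_of_mem_clauseStates this).1⟩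
      rw [Finset.sum_congr rfl hsplit, ← Finset.mul_sum, Finset.sum_comm]
      have hl : ∀ l ∈ V ×ˢ (Finset.univ : Finset Bool),
          ∑ c ∈ Fintype.piFinset (fun i => clauseStates V (s i)),
            levelWeight T (V.erase l.1) (cond l c) =
          2 ^ T * ∏ i, stateWeight (T + 1) V.card (s i) := by
        intro l hl
        have hl : l.1 ∈ V := (Finset.mem_product.1 hl).1
        have hT' : T ≤ (V.erase l.1).card := by
          have := hcard _ hl
          omega
        refine (sum_piFinset_comp (fun i => clauseStates V (s i)) (fun o => o.bind (reduce l))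
          (fun i => nextStates (s i)) (fun i => multiplicity (V.erase l.1).card (s i))
          (clauseStates (V.erase l.1)) (fun i g => sum_reduce_clauseStates hl (s i) g)
          (levelWeight T (V.erase l.1)) (2 ^ T)
          (stateWeight T (V.erase l.1).card) (fun τ => ih _ hT' τ)).trans ?_
        congr 1
        refine Finset.prod_congr rfl fun i _ => ?_
        rw [sum_nextStates, ← hcard _ hl]
      rw [Finset.sum_congr rfl hl, Finset.sum_const, Finset.card_product, Finset.card_univ,
        Fintype.card_bool, nsmul_eq_mul]
      have hV : (V.card : ℝ≥0) ≠ 0 := by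
        have : V.card ≠ 0 := by omega
        exact_mod_cast this
      push_cast
      rw [pow_succ]
      field_simp

/-! ### Leaves, levels and unit propagation for a fixed tuple of clauses -/

open Classical in
/-- The expected number of leaves of the search tree of the tuple of clauses `c` over the
variables `V`, for the procedure that never halts and propagates the unit clause of least index.
The first argument bounds the depth and is meant to be the number of variables. -/
noncomputable def leafCount {N M : ℕ} :
    ℕ → Finset (Fin N) → (Fin M → Option (Clause N)) → ℝ≥0
  | 0, _, _ => 1
  | n + 1, V, c =>
    if (∃ i, c i = some ∅) ∨ ∀ i, c i = none then 1
    else match firstUnit c with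
      | some l => leafCount n (V.erase l.1) (cond l c)
      | none => (V.card : ℝ≥0)⁻¹ *
          ∑ l ∈ V ×ˢ (Finset.univ : Finset Bool), leafCount n (V.erase l.1) (cond l c)

section leafCount

variable {N M : ℕ} {n T : ℕ} {V : Finset (Fin N)} {c : Fin M → Option (Clause N)}

theorem leafCount_of_empty (n : ℕ) (V : Finset (Fin N)) (h : ∃ i, c i = some ∅) :
    leafCount n V c = 1 := by
  cases n with
  | zero => rfl
  | succ n => rw [leafCount, if_pos (Or.inl h)]

theorem leafCount_of_forall_none (n : ℕ) (V : Finset (Fin N)) (h : ∀ i, c i = none) :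
    leafCount n V c = 1 := by
  cases n with
  | zero => rfl
  | succ n => rw [leafCount, if_pos (Or.inr h)]

theorem leafCount_succ_of_firstUnit (h : ¬ ∃ i, c i = some ∅) {l : Literal N}
    (hl : IsFirstUnit c l) : leafCount (n + 1) V c = leafCount n (V.erase l.1) (cond l c) := by
  rw [leafCount, if_neg, firstUnit_eq_some.2 hl]
  rintro (h' | h')
  · exact h h'
  · obtain ⟨i, hi, -⟩ := hl
    rw [h' i] at hi
    simp at hi

theorem leafCount_succ_of_split (h : ¬ ∃ i, c i = some ∅) (h' : ¬ ∀ i, c i = none)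
    (hl : ∀ i l, c i ≠ some {l}) :
    leafCount (n + 1) V c = (V.card : ℝ≥0)⁻¹ *
      ∑ l ∈ V ×ˢ (Finset.univ : Finset Bool), leafCount n (V.erase l.1) (cond l c) := by
  rw [leafCount, if_neg (not_or.2 ⟨h, h'⟩), firstUnit_eq_none.2 hl]

theorem weight_le_one (o : Option (Clause N)) : weight o ≤ 1 := by
  cases o with
  | none => simp [weight]
  | some c =>
    rw [weight]
    split_ifs
    · exact zero_le_one
    · exact NNReal.half_le_self 1
    · exact le_rfl

theorem levelWeight_zero_le_one : levelWeight 0 V c ≤ 1 :=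
  Finset.prod_le_one' fun i _ => weight_le_one (c i)

theorem inv_card_mul_sum_const (V : Finset (Fin N)) (x : ℝ≥0) :
    (V.card : ℝ≥0)⁻¹ * ∑ _l ∈ V ×ˢ (Finset.univ : Finset Bool), x ≤ 2 * x := by
  rw [Finset.sum_const, Finset.card_product, Finset.card_univ, Fintype.card_bool, nsmul_eq_mul]
  rcases eq_or_ne V.card 0 with h | h
  · simp [h]
  · have : (V.card : ℝ≥0) ≠ 0 := by exact_mod_cast h
    push_cast
    field_simp
    exact le_rfl

theorem inv_card_mul_sum_const_eq (hV : V.card ≠ 0) (x : ℝ≥0) :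
    (V.card : ℝ≥0)⁻¹ * ∑ _l ∈ V ×ˢ (Finset.univ : Finset Bool), x = 2 * x := by
  rw [Finset.sum_const, Finset.card_product, Finset.card_univ, Fintype.card_bool, nsmul_eq_mul]
  have : (V.card : ℝ≥0) ≠ 0 := by exact_mod_cast hV
  push_cast
  field_simp

theorem levelWeight_le_two_pow (T : ℕ) (V : Finset (Fin N)) (c : Fin M → Option (Clause N)) :
    levelWeight T V c ≤ 2 ^ T := by
  induction T generalizing V c with
  | zero => simpa using levelWeight_zero_le_one
  | succ T ih =>
    by_cases h0 : ∃ i, c i = some ∅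
    · rw [levelWeight_succ_of_empty h0]
      exact zero_le
    by_cases h1 : ∃ i l, c i = some {l}
    · obtain ⟨l, hl⟩ := exists_isFirstUnit h1
      rw [levelWeight_succ_of_unit h0 hl]
      exact (ih _ _).trans (pow_le_pow_right₀ one_le_two (Nat.le_succ T))
    · push Not at h1
      rw [levelWeight_succ_of_split h0 h1, pow_succ']
      refine le_trans ?_ (inv_card_mul_sum_const V (2 ^ T))
      gcongr
      exact ih _ _

/-- A binary tree has one leaf more than it has branching nodes, and a branching node has
weight `1` because it has neither empty clauses nor unit clauses. -/
theorem leafCount_le (n : ℕ) (V : Finset (Fin N)) (c : Fin M → Option (Clause N)) :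
    leafCount n V c ≤ 1 + ∑ T ∈ Finset.range (n + 1), levelWeight T V c := by
  induction n generalizing V c with
  | zero =>
    rw [leafCount]
    exact le_self_add
  | succ n ih =>
    by_cases h0 : ∃ i, c i = some ∅
    · rw [leafCount_of_empty _ _ h0]
      exact le_self_add
    by_cases hn : ∀ i, c i = none
    · rw [leafCount_of_forall_none _ _ hn]
      exact le_self_add
    by_cases h1 : ∃ i l, c i = some {l}
    · obtain ⟨l, hl⟩ := exists_isFirstUnit h1
      rw [leafCount_succ_of_firstUnit h0 hl, Finset.sum_range_succ']
      refine (ih _ _).trans ?_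
      gcongr 1 + ?_
      refine le_add_of_le_of_nonneg (Finset.sum_le_sum fun T _ => ?_) zero_le
      rw [levelWeight_succ_of_unit h0 hl]
    · push Not at h1
      have hw : levelWeight 0 V c = 1 := by
        rw [levelWeight]
        refine Finset.prod_eq_one fun i _ => ?_
        rcases hc : c i with _ | d
        · rfl
        · rw [weight, if_neg, if_neg]
          · intro h
            obtain ⟨l, rfl⟩ := Finset.card_eq_one.1 h
            exact h1 i l hc
          · intro h
            rw [Finset.card_eq_zero] at h
            exact h0 ⟨i, h ▸ hc⟩
      rw [leafCount_succ_of_split h0 hn h1, Finset.sum_range_succ', hw]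
      have hs : ∀ T, levelWeight (T + 1) V c = (V.card : ℝ≥0)⁻¹ *
          ∑ l ∈ V ×ˢ (Finset.univ : Finset Bool), levelWeight T (V.erase l.1) (cond l c) :=
        fun T => levelWeight_succ_of_split h0 h1
      simp only [hs]
      rw [← Finset.mul_sum, Finset.sum_comm]
      calc (V.card : ℝ≥0)⁻¹ *
            ∑ l ∈ V ×ˢ (Finset.univ : Finset Bool), leafCount n (V.erase l.1) (cond l c)
          ≤ (V.card : ℝ≥0)⁻¹ * ∑ l ∈ V ×ˢ (Finset.univ : Finset Bool),
              (1 + ∑ T ∈ Finset.range (n + 1), levelWeight T (V.erase l.1) (cond l c)) := by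
            gcongr with l
            exact ih _ _
        _ ≤ 2 * 1 + (V.card : ℝ≥0)⁻¹ * ∑ l ∈ V ×ˢ (Finset.univ : Finset Bool),
              ∑ T ∈ Finset.range (n + 1), levelWeight T (V.erase l.1) (cond l c) := by
            rw [Finset.sum_add_distrib, mul_add]
            exact add_le_add (inv_card_mul_sum_const V 1) le_rfl
        _ = _ := by ring

/-- No assignment of the variables satisfies all the clauses. -/
def Unsat (c : Fin M → Option (Clause N)) : Prop :=
  ¬ ∃ b : Fin N → Bool, ∀ i C, c i = some C → ∃ l ∈ C, b l.1 = l.2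

theorem Unsat.cond (hc : Unsat c) (l : Literal N) : Unsat (cond l c) := by
  rintro ⟨b, hb⟩
  refine hc ⟨Function.update b l.1 l.2, fun i C hC => ?_⟩
  by_cases hl : l ∈ C
  · exact ⟨l, hl, by simp⟩
  · obtain ⟨m, hm, hbm⟩ := hb i (C.erase l.neg) (by
      rw [RandomSat.cond, hC, Option.bind_some, reduce, if_neg hl])
    rw [Finset.mem_erase] at hm
    have hne : m.1 ≠ l.1 := fun h => by
      rcases Literal.eq_or_eq_neg h with rfl | rfl
      · exact hl hm.2
      · exact hm.1 rfl
    exact ⟨m, hm.2, by rw [Function.update_of_ne hne, hbm]⟩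

theorem Unsat.not_forall_none (hc : Unsat c) : ¬ ∀ i, c i = none := fun h =>
  hc ⟨fun _ => true, fun i C hC => by simp [h i] at hC⟩

theorem one_le_leafCount (h : n ≤ V.card) : 1 ≤ leafCount n V c := by
  induction n generalizing V c with
  | zero => exact le_rfl
  | succ n ih =>
    by_cases h0 : ∃ i, c i = some ∅
    · rw [leafCount_of_empty _ _ h0]
    by_cases hn : ∀ i, c i = none
    · rw [leafCount_of_forall_none _ _ hn]
    have hV : ∀ x, n ≤ (V.erase x).card := fun x => by
      have := Finset.pred_card_le_card_erase (s := V) (a := x)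
      omega
    by_cases h1 : ∃ i l, c i = some {l}
    · obtain ⟨l, hl⟩ := exists_isFirstUnit h1
      rw [leafCount_succ_of_firstUnit h0 hl]
      exact ih (hV _)
    · push Not at h1
      rw [leafCount_succ_of_split h0 hn h1]
      calc (1 : ℝ≥0) ≤ 2 * 1 := by norm_num
        _ = _ := (inv_card_mul_sum_const_eq (V := V) (by omega) 1).symm
        _ ≤ _ := by
          gcongr
          exact ih (hV _)

/-- In the search tree of an unsatisfiable instance every node has a leaf below it, so that
there are at least as many leaves as nodes of a given depth. -/
theorem levelWeight_le_leafCount (hc : Unsat c) (hT : T ≤ n) (hn : n ≤ V.card) :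
    levelWeight T V c ≤ leafCount n V c := by
  induction T generalizing n V c with
  | zero => exact levelWeight_zero_le_one.trans (one_le_leafCount hn)
  | succ T ih =>
    obtain ⟨n, rfl⟩ : ∃ m, n = m + 1 := ⟨n - 1, by omega⟩
    by_cases h0 : ∃ i, c i = some ∅
    · rw [levelWeight_succ_of_empty h0]
      exact zero_le
    have hV : ∀ x, n ≤ (V.erase x).card := fun x => by
      have := Finset.pred_card_le_card_erase (s := V) (a := x)
      omega
    by_cases h1 : ∃ i l, c i = some {l}
    · obtain ⟨l, hl⟩ := exists_isFirstUnit h1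
      rw [levelWeight_succ_of_unit h0 hl, leafCount_succ_of_firstUnit h0 hl]
      exact ih (hc.cond l) (by omega) (hV _)
    · push Not at h1
      rw [levelWeight_succ_of_split h0 h1, leafCount_succ_of_split h0 hc.not_forall_none h1]
      gcongr with l
      exact ih (hc.cond l) (by omega) (hV _)

theorem reduce_comm {l l' : Literal N} (h : l.1 ≠ l'.1) (C : Clause N) :
    (reduce l C).bind (reduce l') = (reduce l' C).bind (reduce l) := by
  have h1 : l ≠ l'.neg := fun h' => h (by rw [h']; rfl)
  have h2 : l' ≠ l.neg := fun h' => h (by rw [h']; rfl)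
  by_cases hl : l ∈ C <;> by_cases hl' : l' ∈ C <;>
    simp [reduce, hl, hl', h1, h2, Finset.erase_right_comm]

theorem cond_comm {l l' : Literal N} (h : l.1 ≠ l'.1) (c : Fin M → Option (Clause N)) :
    cond l' (cond l c) = cond l (cond l' c) := by
  funext i
  rcases hc : c i with _ | C
  · simp [cond, hc]
  · simp [cond, hc, reduce_comm h]

theorem cond_empty (l : Literal N) (h : ∃ i, c i = some ∅) : ∃ i, cond l c i = some ∅ := by
  obtain ⟨i, hi⟩ := h
  exact ⟨i, by simp [cond, hi, reduce]⟩

/-- Unit propagation is confluent: the number of leaves does not depend on the unit clause that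
is chosen. -/
theorem leafCount_succ_of_unit (h : ¬ ∃ i, c i = some ∅) {l : Literal N}
    (hl : ∃ i, c i = some {l}) :
    leafCount (n + 1) V c = leafCount n (V.erase l.1) (cond l c) := by
  induction n generalizing V c l with
  | zero =>
    obtain ⟨m, hm⟩ := exists_isFirstUnit (hl.imp fun i hi => ⟨l, hi⟩)
    rw [leafCount_succ_of_firstUnit h hm, leafCount, leafCount]
  | succ n ih =>
    obtain ⟨m, hm⟩ := exists_isFirstUnit (hl.imp fun i hi => ⟨l, hi⟩)
    rw [leafCount_succ_of_firstUnit h hm]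
    obtain ⟨i, hi⟩ := hl
    obtain ⟨j, hj, -⟩ := hm
    by_cases hlm : l.1 = m.1
    · rcases Literal.eq_or_eq_neg hlm with rfl | rfl
      · rfl
      · rw [leafCount_of_empty _ _ ⟨i, by simp [cond, hi, reduce, (Literal.neg_ne m).symm]⟩,
          leafCount_of_empty _ _
            ⟨j, by simp [cond, hj, reduce, Literal.neg_ne m, Literal.neg_neg]⟩]
    · have hli : ∃ i, cond m c i = some {l} := by
        refine ⟨i, ?_⟩
        have h1 : m ≠ l := fun h' => hlm (by rw [h'])
        have h2 : m.neg ≠ l := fun h' => hlm (by rw [← h']; rfl)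
        simp [cond, hi, reduce, h1, h2]
      have hmj : ∃ i, cond l c i = some {m} := by
        refine ⟨j, ?_⟩
        have h1 : l ≠ m := fun h' => hlm (by rw [h'])
        have h2 : l.neg ≠ m := fun h' => hlm (by rw [← h']; rfl)
        simp [cond, hj, reduce, h1, h2]
      have e1 : leafCount (n + 1) (V.erase m.1) (cond m c) =
          leafCount n ((V.erase m.1).erase l.1) (cond l (cond m c)) := by
        by_cases h' : ∃ i, cond m c i = some ∅
        · rw [leafCount_of_empty _ _ h', leafCount_of_empty _ _ (cond_empty l h')]
        · exact ih h' hli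
      have e2 : leafCount (n + 1) (V.erase l.1) (cond l c) =
          leafCount n ((V.erase l.1).erase m.1) (cond m (cond l c)) := by
        by_cases h' : ∃ i, cond l c i = some ∅
        · rw [leafCount_of_empty _ _ h', leafCount_of_empty _ _ (cond_empty m h')]
        · exact ih h' hmj
      rw [e1, e2, cond_comm hlm, Finset.erase_right_comm]

theorem cond_update_none (l : Literal N) (j : Fin M) (c : Fin M → Option (Clause N)) :
    cond l (Function.update c j none) = Function.update (cond l c) j none := by
  funext i
  by_cases h : i = j
  · subst h
    simp [cond]
  · simp [cond, h]

/-- A repetition of a clause does not change the search tree, because the copy of least index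
is propagated; it can only decrease the weights. -/
theorem levelWeight_le_update_none {i j : Fin M} (hij : i < j) (hc : c i = c j) :
    levelWeight T V c ≤ levelWeight T V (Function.update c j none) := by
  induction T generalizing V c with
  | zero =>
    rw [levelWeight, levelWeight]
    refine Finset.prod_le_prod' fun i' _ => ?_
    by_cases h : i' = j
    · subst h
      rw [Function.update_self]
      exact weight_le_one _
    · rw [Function.update_of_ne h]
  | succ T ih =>
    have hrec : ∀ l : Literal N, levelWeight T (V.erase l.1) (cond l c) ≤
        levelWeight T (V.erase l.1) (cond l (Function.update c j none)) := by
      intro l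
      rw [cond_update_none]
      exact ih (by simp [cond, hc])
    by_cases h0 : ∃ i, c i = some ∅
    · rw [levelWeight_succ_of_empty h0]
      exact zero_le
    have h0' : ¬ ∃ i, Function.update c j none i = some ∅ := by
      rintro ⟨i', hi'⟩
      by_cases h : i' = j
      · simp [h] at hi'
      · rw [Function.update_of_ne h] at hi'
        exact h0 ⟨i', hi'⟩
    by_cases h1 : ∃ i l, c i = some {l}
    · obtain ⟨l, hl⟩ := exists_isFirstUnit h1
      have hl' : IsFirstUnit (Function.update c j none) l := by
        obtain ⟨i', hi', hmin⟩ := hl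
        have hne : i' ≠ j := by
          rintro rfl
          exact hmin i hij l (hc.trans hi')
        refine ⟨i', by rw [Function.update_of_ne hne, hi'], fun i'' hi'' l' => ?_⟩
        by_cases h : i'' = j
        · simp [h]
        · rw [Function.update_of_ne h]
          exact hmin i'' hi'' l'
      rw [levelWeight_succ_of_unit h0 hl, levelWeight_succ_of_unit h0' hl']
      exact hrec l
    · push Not at h1
      have h1' : ∀ i' l, Function.update c j none i' ≠ some {l} := by
        intro i' l
        by_cases h : i' = j
        · simp [h]
        · rw [Function.update_of_ne h]
          exact h1 i' l
      rw [levelWeight_succ_of_split h0 h1, levelWeight_succ_of_split h0' h1']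
      gcongr with l
      exact hrec l

end leafCount

/-! ### DPLL-UC compared with the procedure that never halts -/

/-- The expectation of `f` under the law `p`. -/
noncomputable def expect {α : Type*} (p : PMF α) (f : α → ℝ≥0∞) : ℝ≥0∞ := ∑' a, p a * f a

section expect

variable {α β : Type*}

theorem expect_pure (a : α) (f : α → ℝ≥0∞) : expect (PMF.pure a) f = f a := by
  rw [expect, tsum_eq_single a]
  · simp
  · intro b hb
    simp [PMF.pure_apply, hb]

theorem expect_bind (p : PMF α) (q : α → PMF β) (f : β → ℝ≥0∞) :
    expect (p.bind q) f = expect p fun a => expect (q a) f := by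
  simp only [expect, PMF.bind_apply, ← ENNReal.tsum_mul_right, ← ENNReal.tsum_mul_left]
  rw [ENNReal.tsum_comm]
  simp only [mul_assoc]

theorem expect_map (p : PMF α) (g : α → β) (f : β → ℝ≥0∞) :
    expect (p.map g) f = expect p fun a => f (g a) := by
  rw [PMF.map, expect_bind]
  simp only [Function.comp_apply, expect_pure]

theorem expect_mono (p : PMF α) {f g : α → ℝ≥0∞} (h : ∀ a ∈ p.support, f a ≤ g a) :
    expect p f ≤ expect p g := by
  refine ENNReal.tsum_le_tsum fun a => ?_
  by_cases ha : p a = 0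
  · simp [ha]
  · gcongr
    exact h a ha

theorem expect_congr (p : PMF α) {f g : α → ℝ≥0∞} (h : ∀ a ∈ p.support, f a = g a) :
    expect p f = expect p g :=
  le_antisymm (expect_mono p fun a ha => (h a ha).le) (expect_mono p fun a ha => (h a ha).ge)

theorem expect_const (p : PMF α) (x : ℝ≥0∞) : expect p (fun _ => x) = x := by
  rw [expect, ENNReal.tsum_mul_right, p.tsum_coe, one_mul]

theorem expect_add (p : PMF α) (f g : α → ℝ≥0∞) :
    expect p (fun a => f a + g a) = expect p f + expect p g := by
  simp only [expect, mul_add]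
  exact ENNReal.tsum_add

theorem expect_mul_left (p : PMF α) (x : ℝ≥0∞) (f : α → ℝ≥0∞) :
    expect p (fun a => x * f a) = x * expect p f := by
  simp only [expect, ← ENNReal.tsum_mul_left]
  exact tsum_congr fun a => by ring

end expect

/-- The tuple of residual clauses of the tuple of clauses `c`. -/
def residualTuple {N M : ℕ} (c : Fin M → Clause N) (A : PartialAssignment N) :
    Fin M → Option (Clause N) := fun i =>
  if ∃ l ∈ c i, A l.1 = some l.2 then none else some ((c i).filter fun l => A l.1 = none)

section residualTuple

variable {N M : ℕ} {c : Fin M → Clause N} {A : PartialAssignment N}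

theorem mem_residual_iff {C : Clause N} :
    C ∈ residual (Finset.univ.image c) A ↔ ∃ i, residualTuple c A i = some C := by
  simp only [residual, Finset.mem_image, Finset.mem_filter, Finset.mem_univ, true_and,
    residualTuple]
  constructor
  · rintro ⟨_, ⟨⟨i, rfl⟩, h⟩, rfl⟩
    refine ⟨i, ?_⟩
    rw [if_neg]
    rintro ⟨l, hl, hl'⟩
    exact h l hl hl'
  · rintro ⟨i, hi⟩
    split_ifs at hi with h
    refine ⟨c i, ⟨⟨i, rfl⟩, fun l hl hl' => h ⟨l, hl, hl'⟩⟩, by simpa using hi⟩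

theorem residual_eq_empty_iff :
    residual (Finset.univ.image c) A = ∅ ↔ ∀ i, residualTuple c A i = none := by
  rw [Finset.eq_empty_iff_forall_notMem]
  simp only [mem_residual_iff, not_exists]
  constructor
  · intro h i
    rcases hi : residualTuple c A i with _ | C
    · rfl
    · exact absurd hi (h C i)
  · intro h C i hi
    simp [h i] at hi

theorem residualTuple_assign {l : Literal N} (hl : A l.1 = none) :
    residualTuple c (A.assign l) = cond l (residualTuple c A) := by
  have hval : ∀ m : Literal N, m.1 ≠ l.1 → (A.assign l) m.1 = A m.1 := fun m hm => by
    rw [PartialAssignment.assign, Function.update_of_ne hm]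
  have hself : (A.assign l) l.1 = some l.2 := by
    rw [PartialAssignment.assign, Function.update_self]
  funext i
  rw [cond]
  by_cases h : ∃ m ∈ c i, A m.1 = some m.2
  · have h' : ∃ m ∈ c i, (A.assign l) m.1 = some m.2 := by
      obtain ⟨m, hm, hm'⟩ := h
      refine ⟨m, hm, ?_⟩
      rw [hval, hm']
      intro h'
      rw [h', hl] at hm'
      simp at hm'
    rw [residualTuple, if_pos h', residualTuple, if_pos h, Option.bind_none]
  · rw [residualTuple, residualTuple, if_neg h, Option.bind_some, reduce]
    by_cases hlc : l ∈ c i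
    · rw [if_pos ⟨l, hlc, hself⟩, if_pos (by simp [hlc, hl])]
    · rw [if_neg, if_neg (by simp [hlc])]
      · congr 1
        ext m
        simp only [Finset.mem_filter, Finset.mem_erase]
        by_cases hm : m.1 = l.1
        · rw [hm, hself]
          rcases Literal.eq_or_eq_neg hm with rfl | rfl
          · simp [hlc]
          · simp
        · rw [hval m hm]
          have : m ≠ l.neg := fun h' => hm (by rw [h']; rfl)
          simp [this]
      · rintro ⟨m, hm, hm'⟩
        by_cases hml : m.1 = l.1
        · rcases Literal.eq_or_eq_neg hml with rfl | rfl
          · exact hlc hm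
          · rw [show l.neg.1 = l.1 from rfl, hself] at hm'
            simp [Literal.neg] at hm'
        · rw [hval m hml] at hm'
          exact h ⟨m, hm, hm'⟩

theorem mem_unset {x : Fin N} : x ∈ A.unset ↔ A x = none := by
  simp [PartialAssignment.unset]

theorem unset_assign (l : Literal N) : (A.assign l).unset = A.unset.erase l.1 := by
  ext x
  rw [Finset.mem_erase, mem_unset, mem_unset, PartialAssignment.assign]
  by_cases h : x = l.1
  · subst h
    simp
  · simp [h]

/-- The expectation under a uniformly random unset literal is an average over the literals of
the unset variables. -/
theorem expect_uniform_literal [Nonempty {l : Literal N // A l.1 = none}] (f : Literal N → ℝ≥0) :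
    expect (PMF.uniformOfFintype {l : Literal N // A l.1 = none}) (fun l => (f l.1 : ℝ≥0∞)) =
      ((2 * (A.unset.card : ℝ≥0))⁻¹ *
        ∑ l ∈ A.unset ×ˢ (Finset.univ : Finset Bool), f l : ℝ≥0) := by
  have hset : A.unset ×ˢ (Finset.univ : Finset Bool) =
      Finset.univ.filter fun l : Literal N => A l.1 = none := by
    ext l
    simp [mem_unset]
  have hcard : Fintype.card {l : Literal N // A l.1 = none} = 2 * A.unset.card := by
    rw [Fintype.card_subtype, ← hset, Finset.card_product, Finset.card_univ, Fintype.card_bool,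
      mul_comm]
  have hpos : (2 * (A.unset.card : ℝ≥0)) ≠ 0 := by
    have := Fintype.card_pos (α := {l : Literal N // A l.1 = none})
    rw [hcard] at this
    exact_mod_cast this.ne'
  rw [expect, tsum_fintype]
  simp only [PMF.uniformOfFintype_apply, hcard]
  rw [← Finset.mul_sum, ENNReal.coe_mul, ENNReal.coe_inv hpos, ENNReal.ofNNReal_finsetSum, hset,
    Finset.sum_subtype (p := fun l : Literal N => A l.1 = none)]
  · push_cast
    rfl
  · simp

theorem sum_literal_neg (V : Finset (Fin N)) (f : Literal N → ℝ≥0) :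
    ∑ l ∈ V ×ˢ (Finset.univ : Finset Bool), f (Literal.neg l) =
      ∑ l ∈ V ×ˢ (Finset.univ : Finset Bool), f l := by
  refine Finset.sum_bij' (fun l _ => Literal.neg l) (fun l _ => Literal.neg l) ?_ ?_ ?_ ?_ ?_
  all_goals simp [Literal.neg]

end residualTuple

section dpllUC

variable {N M : ℕ} {rule : UnitRule N}

theorem expect_splitting (A : PartialAssignment N) [Nonempty {l : Literal N // A l.1 = none}]
    (f : Literal N → ℝ≥0) :
    expect (PMF.uniformOfFintype {l : Literal N // A l.1 = none})
      (fun l => (f l.1 : ℝ≥0∞) + f l.1.neg) =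
      ((A.unset.card : ℝ≥0)⁻¹ *
        ∑ l ∈ A.unset ×ˢ (Finset.univ : Finset Bool), f l : ℝ≥0) := by
  rw [expect_add, expect_uniform_literal, expect_uniform_literal (fun l => f (Literal.neg l)),
    sum_literal_neg, ← ENNReal.coe_add, mul_inv]
  congr 1
  have h2 : (2 : ℝ≥0)⁻¹ + 2⁻¹ = 1 := by
    rw [← two_mul]
    exact mul_inv_cancel₀ two_ne_zero
  rw [← add_mul, ← add_mul, h2, one_mul]

theorem SearchTree.one_le_leaves (t : SearchTree N) : 1 ≤ t.leaves := by
  induction t with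
  | solution => exact le_rfl
  | contradiction => exact le_rfl
  | one l t ih => exact ih
  | two l t₁ t₂ ih₁ ih₂ => exact ih₁.trans (Nat.le_add_right _ _)

theorem SearchTree.leaves_le_nodes (t : SearchTree N) : t.leaves ≤ t.nodes := by
  induction t with
  | solution => exact le_rfl
  | contradiction => exact le_rfl
  | one l t ih => exact ih.trans (Nat.le_succ _)
  | two l t₁ t₂ ih₁ ih₂ => simp only [leaves, nodes]; omega

/-- Every node lies on the path from the root to some leaf, and such a path has at most `n + 1`
nodes, where `n` is the number of unset variables. -/
theorem nodes_le_of_mem_support (F : Formula N) (n : ℕ) (A : PartialAssignment N)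
    (hA : A.unset.card = n) :
    ∀ t ∈ (dpllUC rule F A).support, t.nodes ≤ (n + 1) * t.leaves := by
  induction n using Nat.strong_induction_on generalizing A with
  | _ n ih =>
    have hrec : ∀ l : Literal N, A l.1 = none → ∀ t ∈ (dpllUC rule F (A.assign l)).support,
        t.nodes ≤ n * t.leaves := by
      intro l hl t ht
      have hlt := hA ▸ card_unset_assign_lt hl
      refine (ih _ hlt _ rfl t ht).trans ?_
      gcongr
      omega
    intro t ht
    rw [dpllUC] at ht
    split_ifs at ht with h₁ h₂ h₃
    · rw [PMF.mem_support_pure_iff] at ht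
      subst ht
      simp [SearchTree.nodes, SearchTree.leaves]
    · rw [PMF.mem_support_pure_iff] at ht
      subst ht
      simp [SearchTree.nodes, SearchTree.leaves]
    · rw [PMF.mem_support_bind_iff] at ht
      obtain ⟨l, -, ht⟩ := ht
      rw [PMF.mem_support_map_iff] at ht
      obtain ⟨t, ht, rfl⟩ := ht
      have h1 := hrec l.1 (eq_none_of_mem_residual l.2 (Finset.mem_singleton_self _)) t ht
      have h2 := t.one_le_leaves
      simp only [SearchTree.nodes, SearchTree.leaves]
      linarith
    · rw [PMF.mem_support_bind_iff] at ht
      obtain ⟨l, -, ht⟩ := ht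
      rw [PMF.mem_support_bind_iff] at ht
      obtain ⟨t₁, ht₁, ht⟩ := ht
      have h1 := hrec l.1 l.2 t₁ ht₁
      have h2 := t₁.one_le_leaves
      split_ifs at ht with hs
      · rw [PMF.mem_support_pure_iff] at ht
        subst ht
        simp only [SearchTree.nodes, SearchTree.leaves]
        linarith
      · rw [PMF.mem_support_map_iff] at ht
        obtain ⟨t₂, ht₂, rfl⟩ := ht
        have h3 := hrec l.1.neg l.2 t₂ ht₂
        simp only [SearchTree.nodes, SearchTree.leaves]
        linarith

theorem sat_eq_false_of_mem_support {c : Fin M → Clause N} (n : ℕ) (A : PartialAssignment N)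
    (hA : A.unset.card = n) (hc : Unsat (residualTuple c A)) :
    ∀ t ∈ (dpllUC rule (Finset.univ.image c) A).support, t.sat = false := by
  induction n using Nat.strong_induction_on generalizing A with
  | _ n ih =>
    have hrec : ∀ l : Literal N, A l.1 = none →
        ∀ t ∈ (dpllUC rule (Finset.univ.image c) (A.assign l)).support, t.sat = false :=
      fun l hl => ih _ (hA ▸ card_unset_assign_lt hl) _ rfl
        (by rw [residualTuple_assign hl]; exact hc.cond l)
    intro t ht
    rw [dpllUC] at ht
    split_ifs at ht with h₁ h₂ h₃
    · exact absurd (residual_eq_empty_iff.1 h₁) hc.not_forall_none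
    · rw [PMF.mem_support_pure_iff] at ht
      subst ht
      rfl
    · rw [PMF.mem_support_bind_iff] at ht
      obtain ⟨l, -, ht⟩ := ht
      rw [PMF.mem_support_map_iff] at ht
      obtain ⟨t, ht, rfl⟩ := ht
      exact hrec l.1 (eq_none_of_mem_residual l.2 (Finset.mem_singleton_self _)) t ht
    · rw [PMF.mem_support_bind_iff] at ht
      obtain ⟨l, -, ht⟩ := ht
      rw [PMF.mem_support_bind_iff] at ht
      obtain ⟨t₁, ht₁, ht⟩ := ht
      have h1 := hrec l.1 l.2 t₁ ht₁
      rw [if_neg (by simp [h1]), PMF.mem_support_map_iff] at ht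
      obtain ⟨t₂, ht₂, rfl⟩ := ht
      simp [SearchTree.sat, h1, hrec l.1.neg l.2 t₂ ht₂]

/-- The expected number of leaves of DPLL-UC is at most `leafCount` whatever the rule for unit
clauses, and equal to it for unsatisfiable instances: halting is the only difference between the
two procedures. -/
theorem expect_leaves_dpllUC (c : Fin M → Clause N) (n : ℕ) (A : PartialAssignment N)
    (hA : A.unset.card = n) :
    expect (dpllUC rule (Finset.univ.image c) A) (fun t => (t.leaves : ℝ≥0∞)) ≤
        leafCount n A.unset (residualTuple c A) ∧
      (Unsat (residualTuple c A) →
        expect (dpllUC rule (Finset.univ.image c) A) (fun t => (t.leaves : ℝ≥0∞)) =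
          leafCount n A.unset (residualTuple c A)) := by
  induction n generalizing A with
  | zero =>
    rw [dpllUC, leafCount]
    have hno : ∀ l : Literal N, A l.1 ≠ none := fun l hl => by
      rw [Finset.card_eq_zero] at hA
      simpa [hA] using mem_unset.2 hl
    split_ifs with h₁ h₂ h₃
    · simp [expect_pure, SearchTree.leaves]
    · simp [expect_pure, SearchTree.leaves]
    · obtain ⟨l, hl⟩ := h₃
      exact absurd (eq_none_of_mem_residual hl (Finset.mem_singleton_self _)) (hno l)
    · obtain ⟨l⟩ := exists_unset_literal h₁ h₂
      exact absurd l.2 (hno l.1)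
  | succ n ih =>
    have hA' : ∀ l : Literal N, A l.1 = none → (A.assign l).unset.card = n := fun l hl => by
      rw [unset_assign, Finset.card_erase_of_mem (mem_unset.2 hl), hA]
      rfl
    have hle : ∀ l : Literal N, A l.1 = none →
        expect (dpllUC rule (Finset.univ.image c) (A.assign l)) (fun t => (t.leaves : ℝ≥0∞)) ≤
          leafCount n (A.unset.erase l.1) (cond l (residualTuple c A)) := by
      intro l hl
      have := (ih _ (hA' l hl)).1
      rwa [unset_assign, residualTuple_assign hl] at this
    have heq : Unsat (residualTuple c A) → ∀ l : Literal N, A l.1 = none →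
        expect (dpllUC rule (Finset.univ.image c) (A.assign l)) (fun t => (t.leaves : ℝ≥0∞)) =
          leafCount n (A.unset.erase l.1) (cond l (residualTuple c A)) := by
      intro hc l hl
      have := (ih _ (hA' l hl)).2 (by rw [residualTuple_assign hl]; exact hc.cond l)
      rwa [unset_assign, residualTuple_assign hl] at this
    rw [dpllUC]
    split_ifs with h₁ h₂ h₃
    · rw [leafCount_of_forall_none _ _ (residual_eq_empty_iff.1 h₁)]
      simp [expect_pure, SearchTree.leaves]
    · rw [leafCount_of_empty _ _ (mem_residual_iff.1 h₂)]
      simp [expect_pure, SearchTree.leaves]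
    · rw [mem_residual_iff] at h₂
      have hunit : ∀ l : {l : Literal N // ({l} : Clause N) ∈ residual (Finset.univ.image c) A},
          A l.1.1 = none := fun l => eq_none_of_mem_residual l.2 (Finset.mem_singleton_self _)
      have hv : ∀ l : {l : Literal N // ({l} : Clause N) ∈ residual (Finset.univ.image c) A},
          leafCount n (A.unset.erase l.1.1) (cond l.1 (residualTuple c A)) =
            leafCount (n + 1) A.unset (residualTuple c A) :=
        fun l => (leafCount_succ_of_unit h₂ (mem_residual_iff.1 l.2)).symm
      rw [expect_bind]
      simp only [expect_map, SearchTree.leaves]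
      constructor
      · refine (expect_mono _ fun l _ => (hle l.1 (hunit l)).trans_eq ?_).trans_eq
          (expect_const (rule _ A h₃) _)
        rw [hv l]
      · intro hc
        refine (expect_congr _ fun l _ => (heq hc l.1 (hunit l)).trans ?_).trans
          (expect_const (rule _ A h₃) _)
        rw [hv l]
    · have : Nonempty {l : Literal N // A l.1 = none} := exists_unset_literal h₁ h₂
      rw [leafCount_succ_of_split (fun h => h₂ (mem_residual_iff.2 h))
        (fun h => h₁ (residual_eq_empty_iff.2 h))
        (fun i l h => h₃ ⟨l, mem_residual_iff.2 ⟨i, h⟩⟩), ← expect_splitting]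
      rw [expect_bind]
      simp only [expect_bind]
      have htwo : ∀ (l : {l : Literal N // A l.1 = none}) (t₁ : SearchTree N),
          expect ((dpllUC rule (Finset.univ.image c) (A.assign l.1.neg)).map
            (SearchTree.two l.1 t₁)) (fun t => (t.leaves : ℝ≥0∞)) =
          t₁.leaves + expect (dpllUC rule (Finset.univ.image c) (A.assign l.1.neg))
            (fun t => (t.leaves : ℝ≥0∞)) := by
        intro l t₁
        rw [expect_map]
        simp only [SearchTree.leaves, Nat.cast_add]
        rw [expect_add, expect_const]
      constructor
      · refine expect_mono _ fun l _ => ?_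
        refine le_trans ?_ (add_le_add (hle l.1 l.2) (hle l.1.neg l.2))
        refine (expect_mono _ fun t₁ _ => ?_).trans_eq
          ((expect_add _ _ _).trans (congrArg _ (expect_const _ _)))
        split_ifs with hs
        · rw [expect_pure]
          exact le_self_add
        · exact (htwo l t₁).le
      · intro hc
        refine expect_congr _ fun l _ => ?_
        rw [show A.unset.erase (Literal.neg l.1).1 = A.unset.erase l.1.neg.1 from rfl,
          ← heq hc l.1 l.2, ← heq hc l.1.neg l.2]
        refine (expect_congr _ fun t₁ ht₁ => ?_).trans
          ((expect_add _ _ _).trans (congrArg _ (expect_const _ _)))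
        have hs : t₁.sat = false := sat_eq_false_of_mem_support n _ (hA' l.1 l.2)
          (by rw [residualTuple_assign l.2]; exact hc.cond l.1) t₁ ht₁
        rw [if_neg (by simp [hs])]
        exact htwo l t₁

end dpllUC

/-! ### From tuples of clauses to random instances -/

/-- The tuples of `M` clauses with exactly `k` literals. -/
def clauseTuples (N k M : ℕ) : Finset (Fin M → Clause N) :=
  Fintype.piFinset fun _ => kClauses N k

section clauseTuples

variable {N k M : ℕ}

theorem mem_clauseTuples {c : Fin M → Clause N} :
    c ∈ clauseTuples N k M ↔ ∀ i, c i ∈ kClauses N k := by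
  simp [clauseTuples]

theorem card_kClauses (N k : ℕ) : (kClauses N k).card = 2 ^ k * N.choose k := by
  rw [← clausesOn_univ, card_clausesOn, Finset.card_univ, Fintype.card_fin]

theorem sum_clauseTuples (H : (Fin M → Option (Clause N)) → ℝ≥0) :
    ∑ c ∈ clauseTuples N k M, H (fun i => some (c i)) =
      ∑ c ∈ Fintype.piFinset (fun _ : Fin M => clauseStates (Finset.univ : Finset (Fin N))
        (some k)), H c := by
  refine Finset.sum_bij' (fun c _ i => some (c i)) (fun c _ i => (c i).getD ∅) ?_ ?_ ?_ ?_ ?_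
  · intro c hc
    rw [Fintype.mem_piFinset]
    intro i
    rw [mem_clauseStates_some, clausesOn_univ]
    exact ⟨c i, mem_clauseTuples.1 hc i, rfl⟩
  · intro c hc
    rw [mem_clauseTuples]
    intro i
    have := Fintype.mem_piFinset.1 hc i
    rw [mem_clauseStates_some, clausesOn_univ] at this
    obtain ⟨d, hd, hd'⟩ := this
    rw [hd']
    exact hd
  · intro c hc
    rfl
  · intro c hc
    funext i
    have := Fintype.mem_piFinset.1 hc i
    rw [mem_clauseStates_some] at this
    obtain ⟨d, hd, hd'⟩ := this
    simp [hd']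
  · intro c hc
    rfl

theorem sum_levelWeight_clauseTuples {T : ℕ} (hT : T ≤ N) :
    ∑ c ∈ clauseTuples N k M, levelWeight T Finset.univ (fun i => some (c i)) =
      2 ^ T * (clauseWeight T N k : ℝ≥0) ^ M := by
  rw [sum_clauseTuples (levelWeight T Finset.univ), sum_levelWeight T _ (by simpa using hT)]
  simp [stateWeight]

theorem sum_levelWeight_of_eq {T : ℕ} (hT : T ≤ N) {i j : Fin M} (hij : i < j) :
    ∑ c ∈ (clauseTuples N k M).filter (fun c => c i = c j),
        levelWeight T Finset.univ (fun i => some (c i)) ≤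
      2 ^ T * (clauseWeight T N k : ℝ≥0) ^ (M - 1) := by
  classical
  have h1 := sum_levelWeight (M := M) T (Finset.univ : Finset (Fin N)) (by simpa using hT)
    (Function.update (fun _ => some k) j none)
  rw [← Finset.mul_prod_erase _ _ (Finset.mem_univ j), Function.update_self] at h1
  have h2 : ∀ i' ∈ Finset.univ.erase j, stateWeight T (Finset.univ : Finset (Fin N)).card
      (Function.update (fun _ => some k) j none i') = clauseWeight T N k := by
    intro i' hi'
    rw [Function.update_of_ne (Finset.ne_of_mem_erase hi')]
    simp [stateWeight]
  rw [Finset.prod_congr rfl h2, Finset.prod_const, Finset.card_erase_of_mem (Finset.mem_univ j),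
    stateWeight, one_mul] at h1
  simp only [Finset.card_univ, Fintype.card_fin] at h1
  rw [← h1]
  calc ∑ c ∈ (clauseTuples N k M).filter (fun c => c i = c j),
        levelWeight T Finset.univ (fun i => some (c i))
      ≤ ∑ c ∈ (clauseTuples N k M).filter (fun c => c i = c j),
          levelWeight T Finset.univ (Function.update (fun i => some (c i)) j none) := by
        refine Finset.sum_le_sum fun c hc => levelWeight_le_update_none hij ?_
        rw [(Finset.mem_filter.1 hc).2]
    _ = ∑ c ∈ ((clauseTuples N k M).filter (fun c => c i = c j)).image
          (fun c => Function.update (fun i => some (c i)) j none),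
          levelWeight T Finset.univ c := by
        rw [Finset.sum_image]
        intro c hc d hd hcd
        have hval : ∀ i', i' ≠ j → c i' = d i' := fun i' hi' => by
          have := congrFun hcd i'
          simp only [Function.update_of_ne hi'] at this
          simpa using this
        funext i'
        by_cases hi' : i' = j
        · subst hi'
          rw [← (Finset.mem_filter.1 hc).2, ← (Finset.mem_filter.1 hd).2]
          exact hval i hij.ne
        · exact hval i' hi'
    _ ≤ _ := by
        refine Finset.sum_le_sum_of_subset fun c hc => ?_
        obtain ⟨d, hd, rfl⟩ := Finset.mem_image.1 hc
        rw [Fintype.mem_piFinset]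
        intro i'
        by_cases hi' : i' = j
        · subst hi'
          simp [clauseStates]
        · rw [Function.update_of_ne hi', Function.update_of_ne hi', mem_clauseStates_some,
            clausesOn_univ]
          exact ⟨d i', mem_clauseTuples.1 (Finset.mem_filter.1 hd).1 i', rfl⟩

open Classical in
theorem sum_levelWeight_not_injective {T : ℕ} (hT : T ≤ N) :
    ∑ c ∈ (clauseTuples N k M).filter (fun c => ¬ Function.Injective c),
        levelWeight T Finset.univ (fun i => some (c i)) ≤
      M ^ 2 * (2 ^ T * (clauseWeight T N k : ℝ≥0) ^ (M - 1)) := by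
  calc ∑ c ∈ (clauseTuples N k M).filter (fun c => ¬ Function.Injective c),
        levelWeight T Finset.univ (fun i => some (c i))
      ≤ ∑ c ∈ clauseTuples N k M,
          ∑ p ∈ (Finset.univ : Finset (Fin M × Fin M)).filter (fun p => p.1 < p.2),
            if c p.1 = c p.2 then levelWeight T Finset.univ (fun i => some (c i)) else 0 := by
        rw [Finset.sum_filter]
        refine Finset.sum_le_sum fun c _ => ?_
        split_ifs with hinj
        · exact zero_le
        · rw [Function.not_injective_iff] at hinj
          obtain ⟨i, j, hij, hne⟩ := hinj
          obtain ⟨p, hp, hpc⟩ : ∃ p : Fin M × Fin M, p.1 < p.2 ∧ c p.1 = c p.2 := by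
            rcases lt_or_gt_of_ne hne with h | h
            · exact ⟨(i, j), h, hij⟩
            · exact ⟨(j, i), h, hij.symm⟩
          refine le_trans ?_ (Finset.single_le_sum (fun _ _ => zero_le)
            (Finset.mem_filter.2 ⟨Finset.mem_univ p, hp⟩))
          rw [if_pos hpc]
    _ = ∑ p ∈ (Finset.univ : Finset (Fin M × Fin M)).filter (fun p => p.1 < p.2),
          ∑ c ∈ (clauseTuples N k M).filter (fun c => c p.1 = c p.2),
            levelWeight T Finset.univ (fun i => some (c i)) := by
        rw [Finset.sum_comm]
        exact Finset.sum_congr rfl fun p _ => (Finset.sum_filter _ _).symm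
    _ ≤ ∑ p ∈ (Finset.univ : Finset (Fin M × Fin M)).filter (fun p => p.1 < p.2),
          2 ^ T * (clauseWeight T N k : ℝ≥0) ^ (M - 1) := by
        refine Finset.sum_le_sum fun p hp => sum_levelWeight_of_eq hT ?_
        exact (Finset.mem_filter.1 hp).2
    _ ≤ _ := by
        rw [Finset.sum_const, nsmul_eq_mul]
        gcongr
        have : ((Finset.univ : Finset (Fin M × Fin M)).filter (fun p => p.1 < p.2)).card ≤
            M ^ 2 := by
          refine (Finset.card_filter_le _ _).trans_eq ?_
          rw [Finset.card_univ, Fintype.card_prod, Fintype.card_fin, sq]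
        exact_mod_cast this

theorem card_satisfied_add_choose_le (b : Fin N → Bool) :
    ((kClauses N k).filter fun C => ∃ l ∈ C, b l.1 = l.2).card + N.choose k ≤
      (kClauses N k).card := by
  classical
  rw [← Finset.card_filter_add_card_filter_not (s := kClauses N k)
    (fun C => ∃ l ∈ C, b l.1 = l.2)]
  gcongr
  have h : N.choose k = ((Finset.univ : Finset (Fin N)).powersetCard k).card := by
    rw [Finset.card_powersetCard, Finset.card_univ, Fintype.card_fin]
  rw [h]
  refine Finset.card_le_card_of_injOn (fun S => S.image fun x => (x, !b x)) ?_ ?_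
  · intro S hS
    have hS := (Finset.mem_powersetCard.1 hS).2
    simp only [Finset.coe_filter, Set.mem_ofPred_eq, kClauses, Finset.mem_filter, Finset.mem_univ,
      true_and]
    refine ⟨⟨?_, ?_⟩, ?_⟩
    · rw [Finset.card_image_of_injective _ fun x y h => congrArg Prod.fst h, hS]
    · intro l hl hl'
      rw [Finset.mem_image] at hl hl'
      obtain ⟨x, -, rfl⟩ := hl
      obtain ⟨y, -, hy⟩ := hl'
      simp only [Literal.neg, Prod.mk.injEq, Bool.not_not] at hy
      rw [hy.1] at hy
      simp at hy
    · rintro ⟨l, hl, hl'⟩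
      rw [Finset.mem_image] at hl
      obtain ⟨x, -, rfl⟩ := hl
      simp at hl'
  · intro S _ S' _ h
    have := congrArg (Finset.image Prod.fst) h
    simpa [Finset.image_image, Function.comp_def] using this

open Classical in
/-- First moment bound for the number of satisfiable tuples of clauses. -/
theorem sum_levelWeight_not_unsat (T : ℕ) :
    ∑ c ∈ (clauseTuples N k M).filter (fun c => ¬ Unsat fun i => some (c i)),
        levelWeight T Finset.univ (fun i => some (c i)) ≤
      2 ^ T * (2 ^ N * (((kClauses N k).card - N.choose k : ℕ) : ℝ≥0) ^ M) := by
  have hcard : ((clauseTuples N k M).filter (fun c => ¬ Unsat fun i => some (c i))).card ≤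
      2 ^ N * ((kClauses N k).card - N.choose k) ^ M := by
    calc ((clauseTuples N k M).filter (fun c => ¬ Unsat fun i => some (c i))).card
        ≤ ((Finset.univ : Finset (Fin N → Bool)).biUnion fun b =>
            Fintype.piFinset fun _ : Fin M =>
              (kClauses N k).filter fun C => ∃ l ∈ C, b l.1 = l.2).card := by
          refine Finset.card_le_card fun c hc => ?_
          obtain ⟨hc, hsat⟩ := Finset.mem_filter.1 hc
          obtain ⟨b, hb⟩ := not_not.1 hsat
          refine Finset.mem_biUnion.2 ⟨b, Finset.mem_univ b, Fintype.mem_piFinset.2 fun i => ?_⟩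
          exact Finset.mem_filter.2 ⟨mem_clauseTuples.1 hc i, hb i (c i) rfl⟩
      _ ≤ ∑ b : Fin N → Bool, (Fintype.piFinset fun _ : Fin M =>
              (kClauses N k).filter fun C => ∃ l ∈ C, b l.1 = l.2).card :=
          Finset.card_biUnion_le
      _ ≤ ∑ _b : Fin N → Bool, ((kClauses N k).card - N.choose k) ^ M := by
          refine Finset.sum_le_sum fun b _ => ?_
          rw [Fintype.card_piFinset, Finset.prod_const, Finset.card_univ, Fintype.card_fin]
          gcongr
          have := card_satisfied_add_choose_le (k := k) b
          omega
      _ = _ := by simp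
  calc ∑ c ∈ (clauseTuples N k M).filter (fun c => ¬ Unsat fun i => some (c i)),
        levelWeight T Finset.univ (fun i => some (c i))
      ≤ ∑ c ∈ (clauseTuples N k M).filter (fun c => ¬ Unsat fun i => some (c i)), (2 : ℝ≥0) ^ T :=
        Finset.sum_le_sum fun c _ => levelWeight_le_two_pow T _ _
    _ = ((clauseTuples N k M).filter (fun c => ¬ Unsat fun i => some (c i))).card * 2 ^ T := by
        rw [Finset.sum_const, nsmul_eq_mul]
    _ ≤ _ := by
        rw [mul_comm]
        gcongr
        exact_mod_cast hcard

open Classical in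
/-- A set of `M` clauses has `M!` enumerations. -/
theorem factorial_mul_sum_instances (g : Formula N → ℝ≥0∞) :
    (M.factorial : ℝ≥0∞) * ∑ F ∈ instances N k M, g F =
      ∑ c ∈ (clauseTuples N k M).filter Function.Injective, g (Finset.univ.image c) := by
  have hmaps : ∀ c ∈ (clauseTuples N k M).filter Function.Injective,
      Finset.univ.image c ∈ instances N k M := by
    intro c hc
    obtain ⟨hc, hinj⟩ := Finset.mem_filter.1 hc
    refine Finset.mem_powersetCard.2 ⟨?_, ?_⟩
    · intro C hC
      obtain ⟨i, -, rfl⟩ := Finset.mem_image.1 hC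
      exact mem_clauseTuples.1 hc i
    · rw [Finset.card_image_of_injective _ hinj, Finset.card_univ, Fintype.card_fin]
  rw [← Finset.sum_fiberwise_of_maps_to hmaps, Finset.mul_sum]
  refine Finset.sum_congr rfl fun F hF => ?_
  have hconst : ∀ c ∈ ((clauseTuples N k M).filter Function.Injective).filter
      (fun c => Finset.univ.image c = F), g (Finset.univ.image c) = g F := by
    intro c hc
    rw [(Finset.mem_filter.1 hc).2]
  rw [Finset.sum_congr rfl hconst, Finset.sum_const, nsmul_eq_mul]
  congr 2
  obtain ⟨hFk, hFM⟩ := Finset.mem_powersetCard.1 hF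
  have e₀ : Fin M ≃ F := (Finset.equivFinOfCardEq hFM).symm
  have hcard : Fintype.card (Fin M ≃ F) = M.factorial := by
    rw [Fintype.card_equiv e₀, Fintype.card_fin]
  rw [← hcard, ← Finset.card_univ]
  refine Finset.card_bij (fun (e : Fin M ≃ F) _ i => ((e i : F) : Clause N)) ?_ ?_ ?_
  · intro e _
    refine Finset.mem_filter.2 ⟨Finset.mem_filter.2 ⟨?_, ?_⟩, ?_⟩
    · exact mem_clauseTuples.2 fun i => hFk (e i).2
    · exact fun i j h => e.injective (Subtype.ext h)
    · ext C
      simp only [Finset.mem_image, Finset.mem_univ, true_and]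
      constructor
      · rintro ⟨i, rfl⟩
        exact (e i).2
      · exact fun hC => ⟨e.symm ⟨C, hC⟩, by simp⟩
  · intro e _ e' _ h
    exact Equiv.ext fun i => Subtype.ext (congrFun h i)
  · intro c hc
    obtain ⟨hc, himg⟩ := Finset.mem_filter.1 hc
    have hinj := (Finset.mem_filter.1 hc).2
    have hmem : ∀ i, c i ∈ F := fun i => by
      rw [← himg]
      exact Finset.mem_image_of_mem c (Finset.mem_univ i)
    refine ⟨Equiv.ofBijective (fun i => (⟨c i, hmem i⟩ : F)) ⟨?_, ?_⟩, Finset.mem_univ _, rfl⟩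
    · exact fun i j h => hinj (congrArg Subtype.val h)
    · rintro ⟨C, hC⟩
      rw [← himg] at hC
      obtain ⟨i, -, rfl⟩ := Finset.mem_image.1 hC
      exact ⟨i, rfl⟩

theorem factorial_mul_card_instances :
    M.factorial * (instances N k M).card = (kClauses N k).card.descFactorial M := by
  rw [instances, Finset.card_powersetCard, Nat.descFactorial_eq_factorial_mul_choose]

end clauseTuples

section expectRandom

variable {N k M : ℕ} (rule : UnitRule N)

theorem residualTuple_none (c : Fin M → Clause N) :
    residualTuple c (fun _ => none) = fun i => some (c i) := by
  funext i
  simp [residualTuple]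

theorem unset_none : PartialAssignment.unset (fun _ => none : PartialAssignment N) =
    Finset.univ := by
  simp [PartialAssignment.unset]

theorem expectOn_leaves_le (c : Fin M → Clause N) :
    expectOn rule SearchTree.leaves (Finset.univ.image c) ≤
      leafCount N Finset.univ (fun i => some (c i)) := by
  have := (expect_leaves_dpllUC (rule := rule) c N (fun _ => none) (by simp [unset_none])).1
  rwa [residualTuple_none, unset_none] at this

theorem expectOn_leaves_eq (c : Fin M → Clause N) (hc : Unsat fun i => some (c i)) :
    expectOn rule SearchTree.leaves (Finset.univ.image c) =
      leafCount N Finset.univ (fun i => some (c i)) := by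
  have := (expect_leaves_dpllUC (rule := rule) c N (fun _ => none) (by simp [unset_none])).2
    (by rwa [residualTuple_none])
  rwa [residualTuple_none, unset_none] at this

theorem exists_image_eq (F : Formula N) :
    ∃ (M : ℕ) (c : Fin M → Clause N), Finset.univ.image c = F := by
  refine ⟨F.card, fun i => (F.equivFin.symm i : Clause N), ?_⟩
  ext C
  simp only [Finset.mem_image, Finset.mem_univ, true_and]
  constructor
  · rintro ⟨i, rfl⟩
    exact (F.equivFin.symm i).2
  · exact fun hC => ⟨F.equivFin ⟨C, hC⟩, by simp⟩

theorem expectOn_leaves_ne_top (F : Formula N) : expectOn rule SearchTree.leaves F ≠ ∞ := by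
  obtain ⟨M, c, rfl⟩ := exists_image_eq F
  exact ((expectOn_leaves_le rule c).trans_lt ENNReal.coe_lt_top).ne

theorem expectOn_leaves_le_nodes (F : Formula N) :
    expectOn rule SearchTree.leaves F ≤ expectOn rule SearchTree.nodes F :=
  expect_mono _ fun t _ => by exact_mod_cast t.leaves_le_nodes

theorem expectOn_nodes_le (F : Formula N) :
    expectOn rule SearchTree.nodes F ≤ (N + 1) * expectOn rule SearchTree.leaves F := by
  refine (expect_mono _ fun t ht => ?_).trans_eq (expect_mul_left _ _ _)
  have := nodes_le_of_mem_support F N (fun _ => none) (by simp [unset_none]) t ht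
  exact_mod_cast this

theorem expectOn_nodes_ne_top (F : Formula N) : expectOn rule SearchTree.nodes F ≠ ∞ := by
  refine ((expectOn_nodes_le rule F).trans_lt (ENNReal.mul_lt_top ?_ ?_)).ne
  · exact_mod_cast ENNReal.natCast_lt_top (N + 1)
  · exact (expectOn_leaves_ne_top rule F).lt_top

theorem expectRandom_leaves_le_nodes :
    expectRandom rule SearchTree.leaves k M ≤ expectRandom rule SearchTree.nodes k M := by
  unfold expectRandom
  gcongr with F
  · exact expectOn_nodes_ne_top rule F
  · exact expectOn_leaves_le_nodes rule F

theorem expectRandom_nodes_le :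
    expectRandom rule SearchTree.nodes k M ≤
      (N + 1) * expectRandom rule SearchTree.leaves k M := by
  unfold expectRandom
  rw [← mul_div_assoc, Finset.mul_sum]
  gcongr with F
  have h := ENNReal.toReal_mono
    (ENNReal.mul_ne_top (by exact_mod_cast ENNReal.natCast_ne_top (N + 1))
      (expectOn_leaves_ne_top rule F)) (expectOn_nodes_le rule F)
  rw [ENNReal.toReal_mul] at h
  exact_mod_cast h

theorem descFactorial_mul_expectRandom (hM : M ≤ (kClauses N k).card) :
    ((kClauses N k).card.descFactorial M : ℝ) * expectRandom rule SearchTree.leaves k M =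
      ((M.factorial : ℝ≥0∞) *
        ∑ F ∈ instances N k M, expectOn rule SearchTree.leaves F).toReal := by
  have hcard : ((instances N k M).card : ℝ) ≠ 0 := by
    rw [instances, Finset.card_powersetCard]
    exact_mod_cast (Nat.choose_pos hM).ne'
  rw [← factorial_mul_card_instances, expectRandom, ENNReal.toReal_mul,
    ENNReal.toReal_sum fun F _ => expectOn_leaves_ne_top rule F, ENNReal.toReal_natCast]
  push_cast
  field_simp

theorem expectRandom_leaves_le (hM : M ≤ (kClauses N k).card) :
    ((kClauses N k).card.descFactorial M : ℝ) * expectRandom rule SearchTree.leaves k M ≤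
      ((kClauses N k).card : ℝ) ^ M +
        ∑ T ∈ Finset.range (N + 1), 2 ^ T * (clauseWeight T N k : ℝ) ^ M := by
  classical
  rw [descFactorial_mul_expectRandom rule hM, factorial_mul_sum_instances]
  have h : ∑ c ∈ (clauseTuples N k M).filter Function.Injective,
        expectOn rule SearchTree.leaves (Finset.univ.image c) ≤
      (((kClauses N k).card ^ M +
        ∑ T ∈ Finset.range (N + 1), 2 ^ T * (clauseWeight T N k : ℝ≥0) ^ M : ℝ≥0) : ℝ≥0∞) := by
    calc ∑ c ∈ (clauseTuples N k M).filter Function.Injective,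
          expectOn rule SearchTree.leaves (Finset.univ.image c)
        ≤ ∑ c ∈ (clauseTuples N k M).filter Function.Injective,
            (leafCount N Finset.univ (fun i => some (c i)) : ℝ≥0∞) :=
          Finset.sum_le_sum fun c _ => expectOn_leaves_le rule c
      _ ≤ ∑ c ∈ clauseTuples N k M, (leafCount N Finset.univ (fun i => some (c i)) : ℝ≥0∞) :=
          Finset.sum_le_sum_of_subset (Finset.filter_subset _ _)
      _ = ((∑ c ∈ clauseTuples N k M, leafCount N Finset.univ (fun i => some (c i)) : ℝ≥0) :
            ℝ≥0∞) := by
          rw [ENNReal.ofNNReal_finsetSum]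
      _ ≤ _ := by
          rw [ENNReal.coe_le_coe]
          refine (Finset.sum_le_sum fun c _ => leafCount_le N _ _).trans_eq ?_
          rw [Finset.sum_add_distrib, Finset.sum_comm]
          congr 1
          · simp [clauseTuples]
          · refine Finset.sum_congr rfl fun T hT => ?_
            exact sum_levelWeight_clauseTuples (by simpa [Nat.lt_succ_iff] using hT)
  refine (ENNReal.toReal_mono ENNReal.coe_ne_top h).trans_eq ?_
  rw [ENNReal.coe_toReal]
  push_cast
  rfl

theorem le_expectRandom_leaves (hM : M ≤ (kClauses N k).card) {T : ℕ} (hT : T ≤ N) :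
    2 ^ T * (clauseWeight T N k : ℝ) ^ M ≤
      ((kClauses N k).card.descFactorial M : ℝ) * expectRandom rule SearchTree.leaves k M +
        M ^ 2 * (2 ^ T * (clauseWeight T N k : ℝ) ^ (M - 1)) +
        2 ^ T * (2 ^ N * (((kClauses N k).card - N.choose k : ℕ) : ℝ) ^ M) := by
  classical
  rw [descFactorial_mul_expectRandom rule hM, factorial_mul_sum_instances]
  set S := ∑ c ∈ (clauseTuples N k M).filter Function.Injective,
    expectOn rule SearchTree.leaves (Finset.univ.image c) with hS
  have hStop : S ≠ ∞ := ENNReal.sum_ne_top.2 fun c _ => expectOn_leaves_ne_top rule _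
  let Z : (Fin M → Clause N) → ℝ≥0 := fun c => levelWeight T Finset.univ (fun i => some (c i))
  have h1 : ∑ c ∈ (clauseTuples N k M).filter
      (fun c => Function.Injective c ∧ Unsat fun i => some (c i)), Z c ≤ S.toNNReal := by
    rw [← ENNReal.coe_le_coe, ENNReal.coe_toNNReal hStop, ENNReal.ofNNReal_finsetSum, hS]
    calc ∑ c ∈ (clauseTuples N k M).filter
          (fun c => Function.Injective c ∧ Unsat fun i => some (c i)), (Z c : ℝ≥0∞)
        ≤ ∑ c ∈ (clauseTuples N k M).filter
          (fun c => Function.Injective c ∧ Unsat fun i => some (c i)),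
            expectOn rule SearchTree.leaves (Finset.univ.image c) := by
          refine Finset.sum_le_sum fun c hc => ?_
          have hc := (Finset.mem_filter.1 hc).2.2
          rw [expectOn_leaves_eq rule c hc, ENNReal.coe_le_coe]
          exact levelWeight_le_leafCount hc hT (by simp)
      _ ≤ _ := Finset.sum_le_sum_of_subset
          (Finset.monotone_filter_right _ fun c _ hc => hc.1)
  have h2 : ∑ c ∈ clauseTuples N k M, Z c ≤
      ∑ c ∈ (clauseTuples N k M).filter
        (fun c => Function.Injective c ∧ Unsat fun i => some (c i)), Z c +
      ∑ c ∈ (clauseTuples N k M).filter (fun c => ¬ Function.Injective c), Z c +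
      ∑ c ∈ (clauseTuples N k M).filter (fun c => ¬ Unsat fun i => some (c i)), Z c := by
    rw [Finset.sum_filter, Finset.sum_filter, Finset.sum_filter, ← Finset.sum_add_distrib,
      ← Finset.sum_add_distrib]
    refine Finset.sum_le_sum fun c _ => ?_
    by_cases hi : Function.Injective c <;> by_cases hu : Unsat fun i => some (c i) <;>
      simp [hi, hu]
  have h3 := h2.trans (add_le_add (add_le_add h1 (sum_levelWeight_not_injective hT))
    (sum_levelWeight_not_unsat T))
  rw [sum_levelWeight_clauseTuples hT] at h3
  exact_mod_cast h3

end expectRandom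

/-! ### The threshold -/

/-- The limiting value of the normalized `clauseWeight` after a fraction `t` of the variables has
been set, i.e. the argument of the logarithm in `Omega`. -/
noncomputable def meanWeight (k : ℕ) (t : ℝ) : ℝ :=
  1 - (k : ℝ) / 2 ^ k * t ^ (k - 1) + ((k : ℝ) - 1) / 2 ^ k * t ^ k

theorem Omega_eq (t α : ℝ) (k : ℕ) : Omega t α k = t + α * Real.logb 2 (meanWeight k t) := rfl

theorem mul_pow_sub_mul_pow_lt_one {t : ℝ} (h0 : 0 ≤ t) (h1 : t < 1) (m : ℕ) :
    ((m : ℝ) + 2) * t ^ (m + 1) - ((m : ℝ) + 1) * t ^ (m + 2) < 1 := by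
  induction m with
  | zero => push_cast; nlinarith [sq_nonneg (1 - t), pow_pos (sub_pos.2 h1) 2]
  | succ m ih =>
    have h : 0 ≤ ((m : ℝ) + 2) * t ^ (m + 1) * (1 - t) ^ 2 := by positivity
    have e : ((m : ℝ) + 2) * t ^ (m + 1) - ((m : ℝ) + 1) * t ^ (m + 2) -
        ((((m + 1 : ℕ) : ℝ) + 2) * t ^ (m + 1 + 1) - (((m + 1 : ℕ) : ℝ) + 1) * t ^ (m + 1 + 2)) =
        ((m : ℝ) + 2) * t ^ (m + 1) * (1 - t) ^ 2 := by
      push_cast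
      ring
    linarith

section meanWeight

variable {k : ℕ} {t : ℝ}

theorem meanWeight_add (m : ℕ) (t : ℝ) : meanWeight (m + 2) t =
    1 - (((m : ℝ) + 2) * t ^ (m + 1) - ((m : ℝ) + 1) * t ^ (m + 2)) / 2 ^ (m + 2) := by
  rw [meanWeight, show m + 2 - 1 = m + 1 by omega]
  push_cast
  ring

theorem meanWeight_zero (hk : 2 ≤ k) : meanWeight k 0 = 1 := by
  obtain ⟨m, rfl⟩ : ∃ m, k = m + 2 := ⟨k - 2, by omega⟩
  simp [meanWeight_add]

theorem meanWeight_one (hk : 2 ≤ k) : meanWeight k 1 = 1 - 1 / 2 ^ k := by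
  obtain ⟨m, rfl⟩ : ∃ m, k = m + 2 := ⟨k - 2, by omega⟩
  rw [meanWeight_add]
  ring

theorem lt_meanWeight (hk : 2 ≤ k) (h0 : 0 ≤ t) (h1 : t < 1) :
    1 - 1 / 2 ^ k < meanWeight k t := by
  obtain ⟨m, rfl⟩ : ∃ m, k = m + 2 := ⟨k - 2, by omega⟩
  rw [meanWeight_add]
  have := mul_pow_sub_mul_pow_lt_one h0 h1 m
  gcongr

theorem le_meanWeight (hk : 2 ≤ k) (ht : t ∈ Set.Icc (0 : ℝ) 1) :
    1 - 1 / 2 ^ k ≤ meanWeight k t := by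
  rcases ht.2.lt_or_eq with h | rfl
  · exact (lt_meanWeight hk ht.1 h).le
  · rw [meanWeight_one hk]

theorem meanWeight_le_one (hk : 2 ≤ k) (ht : t ∈ Set.Icc (0 : ℝ) 1) : meanWeight k t ≤ 1 := by
  obtain ⟨m, rfl⟩ : ∃ m, k = m + 2 := ⟨k - 2, by omega⟩
  rw [meanWeight_add]
  have h0 := ht.1
  have h1 : t ^ (m + 2) ≤ t ^ (m + 1) := pow_le_pow_of_le_one ht.1 ht.2 (by omega)
  have h2 : 0 ≤ t ^ (m + 1) := by positivity
  have h3 : 0 ≤ ((m : ℝ) + 2) * t ^ (m + 1) - ((m : ℝ) + 1) * t ^ (m + 2) := by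
    nlinarith [(Nat.cast_nonneg m : (0 : ℝ) ≤ m)]
  have : 0 ≤ (((m : ℝ) + 2) * t ^ (m + 1) - ((m : ℝ) + 1) * t ^ (m + 2)) / 2 ^ (m + 2) := by
    positivity
  linarith

theorem three_fourths_le_one_sub (hk : 2 ≤ k) : (3 / 4 : ℝ) ≤ 1 - 1 / 2 ^ k := by
  have h : (2 : ℝ) ^ 2 ≤ 2 ^ k := pow_le_pow_right₀ one_le_two hk
  have : (1 : ℝ) / 2 ^ k ≤ 1 / 2 ^ 2 := by gcongr
  linarith

theorem meanWeight_pos (hk : 2 ≤ k) (ht : t ∈ Set.Icc (0 : ℝ) 1) : 0 < meanWeight k t :=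
  lt_of_lt_of_le (by linarith [three_fourths_le_one_sub hk]) (le_meanWeight hk ht)

theorem continuous_meanWeight (k : ℕ) : Continuous (meanWeight k) := by
  unfold meanWeight
  fun_prop

theorem continuousOn_Omega (hk : 2 ≤ k) (α : ℝ) :
    ContinuousOn (fun t => Omega t α k) (Set.Icc 0 1) := by
  simp only [Omega_eq, Real.logb]
  refine continuousOn_id.add (continuousOn_const.mul (ContinuousOn.div_const ?_ _))
  exact (continuous_meanWeight k).continuousOn.log fun t ht => (meanWeight_pos hk ht).ne'

theorem exists_omegaC_eq (hk : 2 ≤ k) (α : ℝ) :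
    ∃ t ∈ Set.Icc (0 : ℝ) 1, omegaC α k = Omega t α k ∧
      ∀ t' ∈ Set.Icc (0 : ℝ) 1, Omega t' α k ≤ Omega t α k := by
  obtain ⟨t, ht, h⟩ := isCompact_Icc.exists_sSup_image_eq_and_ge
    (Set.nonempty_Icc.2 zero_le_one) (continuousOn_Omega hk α)
  exact ⟨t, ht, h⟩

theorem Omega_le_omegaC (hk : 2 ≤ k) (α : ℝ) (ht : t ∈ Set.Icc (0 : ℝ) 1) :
    Omega t α k ≤ omegaC α k := by
  obtain ⟨t', -, h, h'⟩ := exists_omegaC_eq hk α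
  rw [h]
  exact h' t ht

theorem logb_one_sub_neg (hk : 2 ≤ k) : Real.logb 2 (1 - 1 / 2 ^ k) < 0 :=
  Real.logb_neg one_lt_two (by linarith [three_fourths_le_one_sub hk])
    (by linarith [show (0 : ℝ) < 1 / 2 ^ k by positivity])

theorem le_logb_meanWeight (hk : 2 ≤ k) (ht : t ∈ Set.Icc (0 : ℝ) 1) :
    Real.logb 2 (1 - 1 / 2 ^ k) ≤ Real.logb 2 (meanWeight k t) :=
  Real.logb_le_logb_of_le one_lt_two (by linarith [three_fourths_le_one_sub hk])
    (le_meanWeight hk ht)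

theorem logb_meanWeight_nonpos (hk : 2 ≤ k) (ht : t ∈ Set.Icc (0 : ℝ) 1) :
    Real.logb 2 (meanWeight k t) ≤ 0 :=
  Real.logb_nonpos one_lt_two (meanWeight_pos hk ht).le (meanWeight_le_one hk ht)

theorem continuous_omegaC (hk : 2 ≤ k) : Continuous fun α => omegaC α k := by
  refine (LipschitzWith.of_le_add_mul (Real.toNNReal (-Real.logb 2 (1 - 1 / 2 ^ k)))
    fun α β => ?_).continuous
  obtain ⟨t, ht, h, -⟩ := exists_omegaC_eq hk α
  have h1 := Omega_le_omegaC hk β ht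
  have h2 := le_logb_meanWeight hk ht
  have h3 := logb_meanWeight_nonpos hk ht
  rw [Real.coe_toNNReal _ (by linarith [logb_one_sub_neg hk]), Real.dist_eq, h]
  rw [Omega_eq] at h1 ⊢
  have h4 : (α - β) * Real.logb 2 (meanWeight k t) ≤
      -Real.logb 2 (1 - 1 / 2 ^ k) * |α - β| := by
    calc (α - β) * Real.logb 2 (meanWeight k t)
        ≤ |(α - β) * Real.logb 2 (meanWeight k t)| := le_abs_self _
      _ = (-Real.logb 2 (meanWeight k t)) * |α - β| := by
          rw [abs_mul, abs_of_nonpos h3, mul_comm]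
      _ ≤ _ := by gcongr
  linarith

/-- `omegaC α k - (2 + α log₂ (1 - 2⁻ᵏ))` is the maximum of the functions
`t - 2 + α (log₂ (meanWeight k t) - log₂ (1 - 2⁻ᵏ))`, which are nondecreasing in `α`. -/
theorem omegaC_sub_mono (hk : 2 ≤ k) {α β : ℝ} (h : α ≤ β) :
    omegaC α k - α * Real.logb 2 (1 - 1 / 2 ^ k) ≤
      omegaC β k - β * Real.logb 2 (1 - 1 / 2 ^ k) := by
  obtain ⟨t, ht, ht', -⟩ := exists_omegaC_eq hk α
  have h1 := Omega_le_omegaC hk β ht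
  have h2 := le_logb_meanWeight hk ht
  rw [ht']
  rw [Omega_eq] at h1 ⊢
  nlinarith [mul_le_mul_of_nonneg_left h2 (sub_nonneg.2 h)]

/-- Where equality holds, the maximum is attained at a point at which `log₂ (meanWeight k t)`
exceeds `log₂ (1 - 2⁻ᵏ)` strictly, since `t < 2`; so there is strict inequality to the right. -/
theorem lt_omegaC_of_eq (hk : 2 ≤ k) {α β : ℝ} (h : α < β)
    (hα : omegaC α k = 2 + α * Real.logb 2 (1 - 1 / 2 ^ k)) :
    2 + β * Real.logb 2 (1 - 1 / 2 ^ k) < omegaC β k := by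
  obtain ⟨t, ht, ht', -⟩ := exists_omegaC_eq hk α
  have h1 := Omega_le_omegaC hk β ht
  have h2 := le_logb_meanWeight hk ht
  rw [ht'] at hα
  rw [Omega_eq] at h1 hα
  have h3 : Real.logb 2 (1 - 1 / 2 ^ k) < Real.logb 2 (meanWeight k t) := by
    refine lt_of_le_of_ne h2 fun h' => ?_
    rw [← h'] at hα
    linarith [ht.2]
  nlinarith [mul_lt_mul_of_pos_left h3 (sub_pos.2 h)]

theorem omegaC_zero (hk : 2 ≤ k) : omegaC 0 k = 1 := by
  refine le_antisymm ?_ ?_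
  · obtain ⟨t, ht, h, -⟩ := exists_omegaC_eq hk 0
    rw [h, Omega_eq, zero_mul, add_zero]
    exact ht.2
  · have := Omega_le_omegaC hk 0 (Set.right_mem_Icc.2 zero_le_one)
    rwa [Omega_eq, zero_mul, add_zero] at this

theorem exists_threshold (hk : 2 ≤ k) :
    ∃ α : ℝ, 0 < α ∧ omegaC α k = 2 + α * Real.logb 2 (1 - 1 / 2 ^ k) := by
  set b := Real.logb 2 (1 - 1 / 2 ^ k) with hb
  have hneg : b < 0 := logb_one_sub_neg hk
  have hβ : 0 ≤ -2 / b := div_nonneg_of_nonpos (by norm_num) hneg.le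
  have hcont : ContinuousOn (fun α => omegaC α k - (2 + α * b)) (Set.Icc 0 (-2 / b)) := by
    have := continuous_omegaC hk
    fun_prop
  have h0 : omegaC 0 k - (2 + 0 * b) = -1 := by
    rw [omegaC_zero hk]
    norm_num
  have h1 : 0 ≤ omegaC (-2 / b) k - (2 + -2 / b * b) := by
    have := Omega_le_omegaC hk (-2 / b) (Set.left_mem_Icc.2 zero_le_one)
    rw [Omega_eq, meanWeight_zero hk, Real.logb_one, mul_zero, add_zero] at this
    rw [div_mul_cancel₀ _ hneg.ne]
    linarith
  obtain ⟨α, hα, hα'⟩ := intermediate_value_Icc hβ hcont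
    ⟨by simp only [h0]; norm_num, h1⟩
  simp only at hα'
  refine ⟨α, lt_of_le_of_ne hα.1 ?_, by linarith⟩
  rintro rfl
  rw [h0] at hα'
  norm_num at hα'

end meanWeight

/-- The argument of the logarithm is the value of `meanWeight 3` at `2023 / 20000`. -/
theorem log_meanWeight_three_bounds :
    Real.log (31885503316167 / 32000000000000) ∈ Set.Icc (-0.00358446 : ℝ) (-0.00358443) := by
  have h := Real.abs_log_sub_add_sum_range_le
    (x := (114496683833 / 32000000000000 : ℝ)) (by rw [abs_of_pos] <;> norm_num) 3
  rw [abs_of_pos (by norm_num : (0 : ℝ) < 114496683833 / 32000000000000),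
    show (1 : ℝ) - 114496683833 / 32000000000000 = 31885503316167 / 32000000000000 by norm_num,
    abs_le] at h
  simp only [Finset.sum_range_succ, Finset.sum_range_zero] at h
  norm_num at h
  constructor <;> norm_num <;> linarith [h.1, h.2]

theorem log_seven_eighths_bounds :
    Real.log (7 / 8) ∈ Set.Icc (-0.13353145 : ℝ) (-0.13353135) := by
  have h := Real.abs_log_sub_add_sum_range_le
    (x := (1 / 8 : ℝ)) (by rw [abs_of_pos] <;> norm_num) 8
  rw [abs_of_pos (by norm_num : (0 : ℝ) < 1 / 8), show (1 : ℝ) - 1 / 8 = 7 / 8 by norm_num,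
    abs_le] at h
  simp only [Finset.sum_range_succ, Finset.sum_range_zero] at h
  norm_num at h
  constructor <;> norm_num <;> linarith [h.1, h.2]

theorem meanWeight_three (t : ℝ) : meanWeight 3 t = 1 - 3 / 8 * t ^ 2 + 1 / 4 * t ^ 3 := by
  norm_num [meanWeight]

/-- The logarithm is bounded by its tangent at `t = 2023 / 20000`, close to the point where the
maximum is attained; the resulting cubic polynomial is negative on `[0, 1]`. -/
theorem omegaC_three_le : omegaC 10.1286 3 ≤ 2 + 10.1286 * Real.logb 2 (1 - 1 / 2 ^ 3) := by
  obtain ⟨t, ht, h, -⟩ := exists_omegaC_eq (k := 3) (by norm_num) 10.1286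
  have hpos := meanWeight_pos (k := 3) (by norm_num) ht
  rw [h, Omega_eq, show (1 : ℝ) - 1 / 2 ^ 3 = 7 / 8 by norm_num, Real.logb, Real.logb]
  have h2 : 0 < Real.log 2 := Real.log_pos one_lt_two
  have hlog := Real.log_le_sub_one_of_pos
    (x := meanWeight 3 t / (31885503316167 / 32000000000000)) (by positivity)
  rw [Real.log_div hpos.ne' (by norm_num)] at hlog
  have key : t * Real.log 2 + 10.1286 * Real.log (meanWeight 3 t) ≤
      2 * Real.log 2 + 10.1286 * Real.log (7 / 8) := by
    have h3 := Real.log_two_gt_d9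
    have h4 := log_meanWeight_three_bounds.2
    have h5 := log_seven_eighths_bounds.1
    have h6 : (2 - t) * 0.6931471803 ≤ (2 - t) * Real.log 2 :=
      mul_le_mul_of_nonneg_left h3.le (by linarith [ht.2])
    rw [meanWeight_three] at hlog ⊢
    have h7 : 0 ≤ (t - 2023 / 20000) ^ 2 * (1 - t) :=
      mul_nonneg (sq_nonneg _) (by linarith [ht.2])
    nlinarith [sq_nonneg (t - 2023 / 20000), ht.1, ht.2,
      sq_nonneg (t - 2023 / 20000 - 0.00001)]
  have e : ∀ x y : ℝ, x + 10.1286 * (y / Real.log 2) = (x * Real.log 2 + 10.1286 * y) /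
      Real.log 2 := fun x y => by field_simp
  rw [e, e]
  gcongr

theorem lt_omegaC_three : 2 + 10.1287 * Real.logb 2 (1 - 1 / 2 ^ 3) < omegaC 10.1287 3 := by
  refine lt_of_lt_of_le ?_ (Omega_le_omegaC (k := 3) (by norm_num) 10.1287
    (t := 2023 / 20000) ⟨by norm_num, by norm_num⟩)
  rw [Omega_eq, meanWeight_three, show (1 : ℝ) - 1 / 2 ^ 3 = 7 / 8 by norm_num, Real.logb,
    Real.logb, show (1 - 3 / 8 * (2023 / 20000) ^ 2 + 1 / 4 * (2023 / 20000) ^ 3 : ℝ) =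
      31885503316167 / 32000000000000 by norm_num]
  have h2 : 0 < Real.log 2 := Real.log_pos one_lt_two
  have key : 2 * Real.log 2 + 10.1287 * Real.log (7 / 8) <
      2023 / 20000 * Real.log 2 + 10.1287 * Real.log (31885503316167 / 32000000000000) := by
    have h3 := Real.log_two_lt_d9
    have h4 := log_meanWeight_three_bounds.1
    have h5 := log_seven_eighths_bounds.2
    linarith
  have e : ∀ x y : ℝ, x + 10.1287 * (y / Real.log 2) = (x * Real.log 2 + 10.1287 * y) /
      Real.log 2 := fun x y => by field_simp
  rw [e, e]
  gcongr

theorem threshold_three {α : ℝ} (hα : omegaC α 3 = 2 + α * Real.logb 2 (1 - 1 / 2 ^ 3)) :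
    10.1286 ≤ α ∧ α < 10.1287 := by
  constructor
  · by_contra! h
    exact absurd (lt_omegaC_of_eq (by norm_num) h hα) omegaC_three_le.not_gt
  · by_contra! h
    have := omegaC_sub_mono (k := 3) (by norm_num) h
    linarith [lt_omegaC_three]

/-! ### The weight of a clause for a large number of variables -/

theorem abs_choose_div_choose_sub_pow_le {N T : ℕ} (hT : T ≤ N) (hN : 0 < N) (j : ℕ)
    (hj : 2 * j ≤ N) :
    |(T.choose j : ℝ) / N.choose j - ((T : ℝ) / N) ^ j| ≤ (j : ℝ) ^ 2 / N := by
  have hN' : (0 : ℝ) < N := by exact_mod_cast hN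
  have hT' : (T : ℝ) ≤ N := by exact_mod_cast hT
  induction j with
  | zero => simp
  | succ j ih =>
    have ih := ih (by omega)
    have hjN : 2 * ((j : ℝ) + 1) ≤ N := by exact_mod_cast hj
    have hj0 : (0 : ℝ) ≤ j := Nat.cast_nonneg j
    have hNj : (0 : ℝ) < N - j := by linarith
    have hc : (0 : ℝ) < N.choose j := by exact_mod_cast Nat.choose_pos (by omega : j ≤ N)
    have hrN : (N.choose (j + 1) : ℝ) * (j + 1) = N.choose j * (N - j) := by
      have := Nat.choose_succ_right_eq N j
      rw [← Nat.cast_sub (by omega)]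
      exact_mod_cast this
    have hrT : (T.choose (j + 1) : ℝ) * (j + 1) = T.choose j * (T - j) := by
      rcases le_or_gt j T with h | h
      · have := Nat.choose_succ_right_eq T j
        rw [← Nat.cast_sub h]
        exact_mod_cast this
      · rw [Nat.choose_eq_zero_of_lt h, Nat.choose_eq_zero_of_lt (by omega)]
        simp
    set r := (T.choose j : ℝ) / N.choose j with hr
    have hr0 : 0 ≤ r := by positivity
    have hr1 : r ≤ 1 := by
      rw [hr, div_le_one hc]
      exact_mod_cast Nat.choose_le_choose j hT
    have hstep : (T.choose (j + 1) : ℝ) / N.choose (j + 1) = r * ((T - j) / (N - j)) := by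
      have h1 : (T.choose (j + 1) : ℝ) = T.choose j * (T - j) / (j + 1) := by
        rw [← hrT]; field_simp
      have h2 : (N.choose (j + 1) : ℝ) = N.choose j * (N - j) / (j + 1) := by
        rw [← hrN]; field_simp
      rw [h1, h2, hr]
      field_simp
    set t := (T : ℝ) / N with ht
    have ht0 : 0 ≤ t := by positivity
    have ht1 : t ≤ 1 := by rw [ht, div_le_one hN']; exact hT'
    have hu : |((T : ℝ) - j) / (N - j) - t| ≤ 2 * j / N := by
      have e : ((T : ℝ) - j) / (N - j) - t = -(j * (1 - t) / (N - j)) := by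
        rw [ht]; field_simp; ring
      rw [e, abs_neg, abs_of_nonneg (by
        have : 0 ≤ 1 - t := by linarith
        positivity), div_le_div_iff₀ hNj hN']
      have h1 : (j : ℝ) * (1 - t) ≤ j := by nlinarith
      have h2 : (N : ℝ) ≤ 2 * (N - j) := by linarith
      calc (j : ℝ) * (1 - t) * N ≤ j * N := by gcongr
        _ ≤ j * (2 * (N - j)) := by gcongr
        _ = _ := by ring
    rw [hstep]
    calc |r * ((T - j) / (N - j)) - t ^ (j + 1)|
        = |r * (((T : ℝ) - j) / (N - j) - t) + t * (r - t ^ j)| := by ring_nf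
      _ ≤ |r * (((T : ℝ) - j) / (N - j) - t)| + |t * (r - t ^ j)| := abs_add_le _ _
      _ = r * |((T : ℝ) - j) / (N - j) - t| + t * |r - t ^ j| := by
          rw [abs_mul, abs_mul, abs_of_nonneg hr0, abs_of_nonneg ht0]
      _ ≤ 1 * (2 * j / N) + 1 * ((j : ℝ) ^ 2 / N) := by gcongr
      _ ≤ ((j + 1 : ℕ) : ℝ) ^ 2 / N := by
          rw [one_mul, one_mul, ← add_div]
          push_cast
          gcongr
          nlinarith

/-- The normalized `clauseWeight` is `meanWeight` up to a term of order `1 / N`, uniformly in the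
number of variables that have been set. -/
theorem abs_clauseWeight_div_sub_le {N T : ℕ} (hT : T ≤ N) (hN : 0 < N) (m : ℕ)
    (hm : 2 * (m + 1) ≤ N) :
    |(clauseWeight T N (m + 1) : ℝ) / (kClauses N (m + 1)).card - meanWeight (m + 1) (T / N)| ≤
      (((m : ℝ) + 1) ^ 2 + (m + 1) * (2 * m + m ^ 2)) / N := by
  have hN' : (0 : ℝ) < N := by exact_mod_cast hN
  have hT' : (T : ℝ) ≤ N := by exact_mod_cast hT
  have hm0 : (0 : ℝ) ≤ m := Nat.cast_nonneg m
  have hmN : 2 * ((m : ℝ) + 1) ≤ N := by exact_mod_cast hm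
  have hNm : (0 : ℝ) < N - m := by linarith
  have h1 := abs_choose_div_choose_sub_pow_le hT hN (m + 1) hm
  have h2 := abs_choose_div_choose_sub_pow_le hT hN m (by omega)
  have hc : (0 : ℝ) < N.choose m := by exact_mod_cast Nat.choose_pos (by omega : m ≤ N)
  have hc' : (0 : ℝ) < N.choose (m + 1) := by exact_mod_cast Nat.choose_pos (by omega : m + 1 ≤ N)
  have hrN : (N.choose (m + 1) : ℝ) * (m + 1) = N.choose m * (N - m) := by
    have := Nat.choose_succ_right_eq N m
    rw [← Nat.cast_sub (by omega)]
    exact_mod_cast this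
  have hW : (clauseWeight T N (m + 1) : ℝ) + (T.choose (m + 1) + T.choose m * (N - T)) =
      2 ^ (m + 1) * N.choose (m + 1) := by
    have := clauseWeight_add hT m
    rw [← Nat.cast_sub hT]
    exact_mod_cast this
  set r := (T.choose m : ℝ) / N.choose m with hr
  set r' := (T.choose (m + 1) : ℝ) / N.choose (m + 1) with hr'
  set t := (T : ℝ) / N with ht
  have hr0 : 0 ≤ r := by positivity
  have hr1 : r ≤ 1 := by
    rw [hr, div_le_one hc]
    exact_mod_cast Nat.choose_le_choose m hT
  have ht0 : 0 ≤ t := by positivity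
  have ht1 : t ≤ 1 := by rw [ht, div_le_one hN']; exact hT'
  set s := ((N : ℝ) - T) / (N - m) with hs
  have hsb : |s - (1 - t)| ≤ 2 * m / N := by
    have e : s - (1 - t) = m * (1 - t) / (N - m) := by
      rw [hs, ht]; field_simp; ring
    rw [e, abs_of_nonneg (by
      have : 0 ≤ 1 - t := by linarith
      positivity), div_le_div_iff₀ hNm hN']
    have h1 : (m : ℝ) * (1 - t) ≤ m := by nlinarith
    have h2 : (N : ℝ) ≤ 2 * (N - m) := by linarith
    calc (m : ℝ) * (1 - t) * N ≤ m * N := by gcongr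
      _ ≤ m * (2 * (N - m)) := by gcongr
      _ = _ := by ring
  have hq : (clauseWeight T N (m + 1) : ℝ) / (kClauses N (m + 1)).card =
      1 - (r' + (m + 1) * (r * s)) / 2 ^ (m + 1) := by
    rw [card_kClauses]
    push_cast
    have e : (m + 1) * (r * s) = T.choose m * (N - T) / N.choose (m + 1) := by
      have h3 : (N.choose (m + 1) : ℝ) = N.choose m * (N - m) / (m + 1) := by
        rw [← hrN]; field_simp
      rw [h3, hr, hs]
      field_simp
    rw [e, hr', ← add_div, div_div, eq_sub_iff_add_eq, mul_comm ((N.choose (m + 1) : ℝ)),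
      ← add_div, hW]
    exact div_self (by positivity)
  have hf : meanWeight (m + 1) t =
      1 - (t ^ (m + 1) + (m + 1) * (t ^ m * (1 - t))) / 2 ^ (m + 1) := by
    rw [meanWeight, show m + 1 - 1 = m by omega]
    push_cast
    ring
  rw [hq, hf]
  have hmain : |(r' + (m + 1) * (r * s)) - (t ^ (m + 1) + (m + 1) * (t ^ m * (1 - t)))| ≤
      (((m : ℝ) + 1) ^ 2 + (m + 1) * (2 * m + m ^ 2)) / N := by
    calc |(r' + (m + 1) * (r * s)) - (t ^ (m + 1) + (m + 1) * (t ^ m * (1 - t)))|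
        = |(r' - t ^ (m + 1)) + (m + 1) * (r * (s - (1 - t)) + (1 - t) * (r - t ^ m))| := by
          ring_nf
      _ ≤ |r' - t ^ (m + 1)| + |(m + 1) * (r * (s - (1 - t)) + (1 - t) * (r - t ^ m))| :=
          abs_add_le _ _
      _ ≤ |r' - t ^ (m + 1)| + (m + 1) * (r * |s - (1 - t)| + (1 - t) * |r - t ^ m|) := by
          rw [abs_mul, abs_of_nonneg (by positivity : (0 : ℝ) ≤ m + 1)]
          gcongr
          refine (abs_add_le _ _).trans_eq ?_
          rw [abs_mul, abs_mul, abs_of_nonneg hr0, abs_of_nonneg (by linarith : 0 ≤ 1 - t)]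
      _ ≤ ((m + 1 : ℕ) : ℝ) ^ 2 / N + (m + 1) * (1 * (2 * m / N) + 1 * ((m : ℝ) ^ 2 / N)) := by
          gcongr
          linarith
      _ = _ := by push_cast; ring
  rw [show ∀ a b c : ℝ, 1 - a / c - (1 - b / c) = -((a - b) / c) by intros; ring, abs_neg,
    abs_div, abs_of_pos (by positivity : (0 : ℝ) < 2 ^ (m + 1))]
  exact (div_le_self (abs_nonneg _) (one_le_pow₀ one_le_two)).trans hmain

theorem exists_abs_clauseWeight_div_sub_le {k : ℕ} (hk : 1 ≤ k) :
    ∃ C : ℝ, 0 ≤ C ∧ ∀ᶠ N : ℕ in atTop, ∀ T ≤ N,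
      |(clauseWeight T N k : ℝ) / (kClauses N k).card - meanWeight k (T / N)| ≤ C / N := by
  obtain ⟨m, rfl⟩ : ∃ m, k = m + 1 := ⟨k - 1, by omega⟩
  refine ⟨((m : ℝ) + 1) ^ 2 + (m + 1) * (2 * m + m ^ 2), by positivity, ?_⟩
  filter_upwards [eventually_ge_atTop (2 * (m + 1))] with N hN T hT
  exact abs_clauseWeight_div_sub_le hT (by omega) m hN

/-- For `k ≥ 3` there are many more clauses than pairs of clauses in an instance. -/
theorem eventually_mul_sq_le_card {k : ℕ} (hk : 3 ≤ k) (c : ℝ) :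
    ∀ᶠ N : ℕ in atTop, c * (N : ℝ) ^ 2 ≤ (kClauses N k).card := by
  filter_upwards [eventually_ge_atTop (2 * k),
    eventually_ge_atTop ⌈8 * k.factorial * c⌉₊] with N hN hN'
  have hc : 8 * k.factorial * c ≤ N := (Nat.le_ceil _).trans (by exact_mod_cast hN')
  have hf : (0 : ℝ) < k.factorial := by exact_mod_cast Nat.factorial_pos k
  have h1 : ((N : ℝ) / 2) ≤ ((N + 1 - k : ℕ) : ℝ) := by
    rw [Nat.cast_sub (by omega)]
    push_cast
    have : 2 * (k : ℝ) ≤ N := by exact_mod_cast hN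
    linarith
  have h2 : (1 : ℝ) ≤ (N : ℝ) / 2 := by
    have : (2 : ℝ) ≤ N := by exact_mod_cast (by omega : 2 ≤ N)
    linarith
  have h3 : ((N : ℝ) / 2) ^ 3 / k.factorial ≤ N.choose k := by
    refine le_trans ?_ (Nat.pow_le_choose k N)
    gcongr
    calc ((N : ℝ) / 2) ^ 3 ≤ ((N : ℝ) / 2) ^ k := pow_le_pow_right₀ h2 hk
      _ ≤ _ := by gcongr
  have h4 : (N.choose k : ℝ) ≤ (kClauses N k).card := by
    rw [card_kClauses]
    exact_mod_cast Nat.le_mul_of_pos_left _ (by positivity)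
  refine le_trans ?_ (h3.trans h4)
  rw [le_div_iff₀ hf]
  nlinarith [mul_le_mul_of_nonneg_right hc (sq_nonneg (N : ℝ))]

/-! ### Exponential growth of the expected size -/

section asymptotics

variable {k : ℕ} {α : ℝ}

theorem rpow_le_pow_floor {x y : ℝ} (hx : 0 < x) (hx1 : x ≤ 1) (hy : 0 ≤ y) :
    x ^ y ≤ x ^ ⌊y⌋₊ := by
  rw [← Real.rpow_natCast]
  exact Real.rpow_le_rpow_of_exponent_ge hx hx1 (Nat.floor_le hy)

theorem pow_floor_le_two_mul {x y : ℝ} (hx : 1 / 2 ≤ x) (hx1 : x ≤ 1) :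
    x ^ ⌊y⌋₊ ≤ 2 * x ^ y := by
  have hx0 : 0 < x := by linarith
  have h1 : x ^ ((⌊y⌋₊ : ℝ) + 1) ≤ x ^ y :=
    Real.rpow_le_rpow_of_exponent_ge hx0 hx1 (Nat.lt_floor_add_one y).le
  rw [Real.rpow_add_one hx0.ne', Real.rpow_natCast] at h1
  have h2 : 0 < x ^ ⌊y⌋₊ := pow_pos hx0 _
  nlinarith

theorem two_pow_mul_rpow {N T : ℕ} (hN : 0 < N) {x : ℝ} (hx : 0 < x) (α : ℝ) :
    (2 : ℝ) ^ T * x ^ (α * N) = 2 ^ ((N : ℝ) * (T / N + α * Real.logb 2 x)) := by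
  have hN' : (N : ℝ) ≠ 0 := by exact_mod_cast hN.ne'
  rw [mul_add, Real.rpow_add two_pos, mul_div_cancel₀ _ hN', Real.rpow_natCast]
  congr 1
  nth_rewrite 1 [← Real.rpow_logb two_pos (by norm_num) hx]
  rw [← Real.rpow_mul zero_le_two]
  ring_nf

theorem omegaC_nonneg (hk : 2 ≤ k) (α : ℝ) : 0 ≤ omegaC α k := by
  have := Omega_le_omegaC hk α (Set.left_mem_Icc.2 zero_le_one)
  rwa [Omega_eq, meanWeight_zero hk, Real.logb_one, mul_zero, add_zero] at this

theorem card_pow_le_two_mul_descFactorial {K M : ℕ} (h : 2 * (M : ℝ) ^ 2 ≤ K) (hM : M ≤ K) :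
    (K : ℝ) ^ M ≤ 2 * K.descFactorial M := by
  rcases Nat.eq_zero_or_pos K with rfl | hK
  · obtain rfl : M = 0 := by omega
    norm_num
  have hK' : (0 : ℝ) < K := by exact_mod_cast hK
  have h1 : ((K : ℝ) - M) ^ M ≤ K.descFactorial M := by
    calc ((K : ℝ) - M) ^ M ≤ ((K + 1 - M : ℕ) : ℝ) ^ M := by
          have h3 : (M : ℝ) ≤ K := by exact_mod_cast hM
          gcongr
          rw [Nat.cast_sub (by omega)]
          push_cast
          linarith
      _ ≤ _ := by exact_mod_cast Nat.pow_sub_le_descFactorial K M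
  have h2 : 1 + (M : ℝ) * (-(M / K)) ≤ (1 + -(M / K : ℝ)) ^ M := by
    refine one_add_mul_le_pow ?_ M
    have : (M : ℝ) / K ≤ 1 := by
      rw [div_le_one hK']
      exact_mod_cast hM
    linarith
  have h3 : (1 / 2 : ℝ) ≤ 1 + (M : ℝ) * (-(M / K)) := by
    have : (M : ℝ) * (M / K) ≤ 1 / 2 := by
      rw [← mul_div_assoc, div_le_iff₀ hK']
      nlinarith
    linarith
  have h4 : ((K : ℝ) - M) ^ M = K ^ M * (1 + -(M / K : ℝ)) ^ M := by
    rw [← mul_pow]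
    congr 1
    field_simp
    ring
  have h5 : (0 : ℝ) < K ^ M := by positivity
  nlinarith [mul_le_mul_of_nonneg_left (h3.trans h2) h5.le]

/-- For `M = ⌊α N⌋` the power `M` of the normalized `clauseWeight` and of `meanWeight` agree up
to constant factors. -/
theorem exists_pow_clauseWeight_bounds (hk : 3 ≤ k) (hα : 0 < α) :
    ∃ A : ℝ, 1 ≤ A ∧ ∀ᶠ N : ℕ in atTop, ∀ T ≤ N,
      1 / 2 ≤ (clauseWeight T N k : ℝ) / (kClauses N k).card ∧
      2 ^ T * ((clauseWeight T N k : ℝ) / (kClauses N k).card) ^ ⌊α * N⌋₊ ≤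
        A * 2 ^ ((N : ℝ) * Omega (T / N) α k) ∧
      2 ^ ((N : ℝ) * Omega (T / N) α k) ≤
        A * (2 ^ T * ((clauseWeight T N k : ℝ) / (kClauses N k).card) ^ ⌊α * N⌋₊) := by
  obtain ⟨C, hC, hev⟩ := exists_abs_clauseWeight_div_sub_le (k := k) (by omega)
  have hA1 : 1 ≤ Real.exp (4 * C * α) := Real.one_le_exp (by positivity)
  refine ⟨2 * Real.exp (4 * C * α), by linarith, ?_⟩
  filter_upwards [hev, eventually_ge_atTop 1, eventually_ge_atTop ⌈4 * C⌉₊] with N hN hN1 hNC T hT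
  have hN' : (0 : ℝ) < N := by exact_mod_cast hN1
  have hCN : 4 * C ≤ N := (Nat.le_ceil _).trans (by exact_mod_cast hNC)
  have hq := abs_le.1 (hN T hT)
  have ht : (T : ℝ) / N ∈ Set.Icc (0 : ℝ) 1 :=
    ⟨by positivity, by rw [div_le_one hN']; exact_mod_cast hT⟩
  have hf := le_meanWeight (k := k) (by omega) ht
  have hf1 := meanWeight_le_one (k := k) (by omega) ht
  have hb := three_fourths_le_one_sub (k := k) (by omega)
  rw [Omega_eq]
  set q := (clauseWeight T N k : ℝ) / (kClauses N k).card
  set f := meanWeight k (T / N)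
  set M := ⌊α * N⌋₊
  have hf0 : 0 < f := by linarith
  have hCN4 : C / N ≤ 1 / 4 := by
    rw [div_le_iff₀ hN']
    linarith
  have hCN0 : 0 ≤ C / N := by positivity
  have hMα : (M : ℝ) * (C / N) ≤ C * α := by
    have : (M : ℝ) ≤ α * N := Nat.floor_le (by positivity)
    calc (M : ℝ) * (C / N) ≤ α * N * (C / N) := by gcongr
      _ = C * α := by field_simp
  have hexpM : ∀ x : ℝ, Real.exp x ^ M = Real.exp (M * x) := fun x => (Real.exp_nat_mul x M).symm
  have hq0 : 1 / 2 ≤ q := by linarith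
  have hup : q ^ M ≤ f ^ M * Real.exp (4 * C * α) := by
    have h1 : q ≤ f * Real.exp (2 * (C / N)) := by
      have := Real.add_one_le_exp (2 * (C / N))
      nlinarith
    calc q ^ M ≤ (f * Real.exp (2 * (C / N))) ^ M := by gcongr
      _ = f ^ M * Real.exp (M * (2 * (C / N))) := by rw [mul_pow, hexpM]
      _ ≤ _ := by
        have : 0 ≤ C * α := by positivity
        exact mul_le_mul_of_nonneg_left (Real.exp_le_exp.2 (by linarith)) (by positivity)
  have hlow : f ^ M ≤ q ^ M * Real.exp (4 * C * α) := by
    have h1 : f ≤ q * Real.exp (4 * (C / N)) := by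
      have h2 := Real.add_one_le_exp (4 * (C / N))
      have h3 : f * (1 - 2 * (C / N)) ≤ q := by nlinarith
      have h4 : 1 ≤ (1 - 2 * (C / N)) * (4 * (C / N) + 1) := by nlinarith
      calc f = f * 1 := (mul_one f).symm
        _ ≤ f * ((1 - 2 * (C / N)) * (4 * (C / N) + 1)) := by gcongr
        _ = (f * (1 - 2 * (C / N))) * (4 * (C / N) + 1) := by ring
        _ ≤ q * Real.exp (4 * (C / N)) := by gcongr
    calc f ^ M ≤ (q * Real.exp (4 * (C / N))) ^ M := by gcongr
      _ = q ^ M * Real.exp (M * (4 * (C / N))) := by rw [mul_pow, hexpM]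
      _ ≤ _ := mul_le_mul_of_nonneg_left (Real.exp_le_exp.2 (by linarith)) (by positivity)
  have hfM1 : f ^ (α * (N : ℝ)) ≤ f ^ M := rpow_le_pow_floor hf0 hf1 (by positivity)
  have hfM2 : f ^ M ≤ 2 * f ^ (α * (N : ℝ)) := pow_floor_le_two_mul (by linarith) hf1
  rw [← two_pow_mul_rpow (by omega) hf0]
  refine ⟨hq0, ?_, ?_⟩
  · calc (2 : ℝ) ^ T * q ^ M ≤ 2 ^ T * (2 * f ^ (α * (N : ℝ)) * Real.exp (4 * C * α)) := by
          gcongr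
          exact hup.trans (by gcongr)
      _ = _ := by ring
  · have hE : 0 ≤ (2 : ℝ) ^ T * (q ^ M * Real.exp (4 * C * α)) := by positivity
    calc (2 : ℝ) ^ T * f ^ (α * (N : ℝ)) ≤ 2 ^ T * (q ^ M * Real.exp (4 * C * α)) := by
          gcongr
          exact hfM1.trans hlow
      _ ≤ 2 * (2 ^ T * (q ^ M * Real.exp (4 * C * α))) := by linarith
      _ = _ := by ring

theorem eventually_size_bounds (hk : 3 ≤ k) (hα : 0 < α) :
    ∀ᶠ N : ℕ in atTop, 4 * ((⌊α * N⌋₊ : ℕ) : ℝ) ^ 2 ≤ (kClauses N k).card ∧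
      ⌊α * N⌋₊ ≤ (kClauses N k).card ∧ 0 < (kClauses N k).card := by
  filter_upwards [eventually_mul_sq_le_card hk (4 * α ^ 2), eventually_mul_sq_le_card hk 1,
    eventually_ge_atTop 1] with N h1 h2 hN
  have hN' : (1 : ℝ) ≤ N := by exact_mod_cast hN
  have hM : ((⌊α * N⌋₊ : ℕ) : ℝ) ≤ α * N := Nat.floor_le (by positivity)
  have h3 : 4 * ((⌊α * N⌋₊ : ℕ) : ℝ) ^ 2 ≤ (kClauses N k).card := by
    refine le_trans ?_ h1
    calc 4 * ((⌊α * N⌋₊ : ℕ) : ℝ) ^ 2 ≤ 4 * (α * N) ^ 2 := by gcongr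
      _ = _ := by ring
  refine ⟨h3, ?_, ?_⟩
  · have h4 : 4 * ⌊α * N⌋₊ ^ 2 ≤ (kClauses N k).card := by exact_mod_cast h3
    nlinarith
  · have : (0 : ℝ) < (kClauses N k).card := by nlinarith
    exact_mod_cast this

theorem exists_expectRandom_nodes_le (hk : 3 ≤ k) (hα : 0 < α) :
    ∃ A : ℝ, 0 < A ∧ ∀ᶠ N : ℕ in atTop, ∀ rule : UnitRule N,
      expectRandom rule SearchTree.nodes k ⌊α * N⌋₊ ≤
        A * ((N : ℝ) + 1) ^ 2 * 2 ^ ((N : ℝ) * omegaC α k) := by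
  obtain ⟨A, hA, hev⟩ := exists_pow_clauseWeight_bounds hk hα
  refine ⟨4 * A, by linarith, ?_⟩
  filter_upwards [hev, eventually_size_bounds hk hα, eventually_ge_atTop 1]
    with N hN ⟨hM2, hMK, hK⟩ hN1 rule
  have hN' : (1 : ℝ) ≤ N := by exact_mod_cast hN1
  have hle := expectRandom_leaves_le rule hMK
  have hdesc := card_pow_le_two_mul_descFactorial
    (by nlinarith [sq_nonneg ((⌊α * N⌋₊ : ℕ) : ℝ)]) hMK
  refine (expectRandom_nodes_le rule).trans ?_
  set M := ⌊α * N⌋₊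
  set K := (kClauses N k).card
  set E := expectRandom rule SearchTree.leaves k M
  set ω := omegaC α k
  have hK' : (0 : ℝ) < K := by exact_mod_cast hK
  have hKM : (0 : ℝ) < (K : ℝ) ^ M := by positivity
  have hE0 : 0 ≤ E := by
    unfold E expectRandom
    positivity
  have hT : ∀ T ∈ Finset.range (N + 1),
      2 ^ T * (clauseWeight T N k : ℝ) ^ M ≤ (K : ℝ) ^ M * (A * 2 ^ ((N : ℝ) * ω)) := by
    intro T hT
    have hT : T ≤ N := Nat.lt_succ_iff.1 (Finset.mem_range.1 hT)
    have h1 := (hN T hT).2.1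
    have h2 : Omega (T / N) α k ≤ ω := Omega_le_omegaC (by omega) α
      ⟨by positivity, by rw [div_le_one (by linarith)]; exact_mod_cast hT⟩
    calc 2 ^ T * (clauseWeight T N k : ℝ) ^ M
        = (K : ℝ) ^ M * (2 ^ T * ((clauseWeight T N k : ℝ) / K) ^ M) := by
          rw [div_pow]
          field_simp
      _ ≤ (K : ℝ) ^ M * (A * 2 ^ ((N : ℝ) * Omega (T / N) α k)) := by gcongr
      _ ≤ _ := by
          gcongr
          exact one_le_two
  have hω : (1 : ℝ) ≤ 2 ^ ((N : ℝ) * ω) :=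
    Real.one_le_rpow one_le_two (mul_nonneg (by linarith) (omegaC_nonneg (by omega) α))
  have h3 : (K : ℝ) ^ M * E ≤ (K : ℝ) ^ M *
      (2 * (1 + ((N : ℝ) + 1) * (A * 2 ^ ((N : ℝ) * ω)))) := by
    calc (K : ℝ) ^ M * E ≤ 2 * K.descFactorial M * E := by gcongr
      _ = 2 * (K.descFactorial M * E) := by ring
      _ ≤ 2 * ((K : ℝ) ^ M + ∑ T ∈ Finset.range (N + 1), 2 ^ T * (clauseWeight T N k : ℝ) ^ M) := by
          gcongr
      _ ≤ 2 * ((K : ℝ) ^ M + ∑ _T ∈ Finset.range (N + 1),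
            (K : ℝ) ^ M * (A * 2 ^ ((N : ℝ) * ω))) :=
          mul_le_mul_of_nonneg_left (add_le_add le_rfl (Finset.sum_le_sum hT)) zero_le_two
      _ = _ := by
          rw [Finset.sum_const, Finset.card_range, nsmul_eq_mul]
          push_cast
          ring
  have h4 := le_of_mul_le_mul_left h3 hKM
  calc ((N : ℝ) + 1) * E
      ≤ (N + 1) * (2 * (1 + ((N : ℝ) + 1) * (A * 2 ^ ((N : ℝ) * ω)))) := by gcongr
    _ ≤ (N + 1) * (2 * (((N : ℝ) + 1) * (A * 2 ^ ((N : ℝ) * ω)) +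
          ((N : ℝ) + 1) * (A * 2 ^ ((N : ℝ) * ω)))) := by
        gcongr
        have h5 : (1 : ℝ) ≤ A * 2 ^ ((N : ℝ) * ω) := by nlinarith
        nlinarith
    _ = _ := by ring

/-- Lower bound from one level `T` of the tree: the subtracted term is the contribution of the
satisfiable instances. -/
theorem exists_le_expectRandom_leaves (hk : 3 ≤ k) (hα : 0 < α) :
    ∃ A : ℝ, 0 < A ∧ ∀ᶠ N : ℕ in atTop, ∀ rule : UnitRule N, ∀ T ≤ N,
      A * 2 ^ ((N : ℝ) * Omega (T / N) α k) ≤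
        expectRandom rule SearchTree.leaves k ⌊α * N⌋₊ +
          2 * 2 ^ ((N : ℝ) * (2 + α * Real.logb 2 (1 - 1 / 2 ^ k))) := by
  obtain ⟨A, hA, hev⟩ := exists_pow_clauseWeight_bounds hk hα
  refine ⟨1 / (2 * A), by positivity, ?_⟩
  filter_upwards [hev, eventually_size_bounds hk hα, eventually_ge_atTop 1]
    with N hN ⟨hM2, hMK, hK⟩ hN1 rule T hT
  have hle := le_expectRandom_leaves rule hMK hT
  obtain ⟨hq, -, hlow⟩ := hN T hT
  have hb := three_fourths_le_one_sub (k := k) (by omega)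
  have hsub : ((kClauses N k).card - N.choose k : ℕ) =
      ((kClauses N k).card : ℝ) * (1 - 1 / 2 ^ k) := by
    rw [card_kClauses, Nat.cast_sub (Nat.le_mul_of_pos_left _ (by positivity))]
    push_cast
    field_simp
  rw [hsub] at hle
  set M := ⌊α * N⌋₊
  set K := (kClauses N k).card
  set E := expectRandom rule SearchTree.leaves k M
  set W := (clauseWeight T N k : ℝ)
  set b := (1 : ℝ) - 1 / 2 ^ k
  have hK' : (0 : ℝ) < K := by exact_mod_cast hK
  have hKM : (0 : ℝ) < (K : ℝ) ^ M := by positivity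
  have hE0 : 0 ≤ E := by
    unfold E expectRandom
    positivity
  have hW : (K : ℝ) / 2 ≤ W := by
    rw [le_div_iff₀ hK'] at hq
    linarith
  have hW0 : 0 < W := by linarith
  have hdup : (M : ℝ) ^ 2 * (2 ^ T * W ^ (M - 1)) ≤ 1 / 2 * (2 ^ T * W ^ M) := by
    rcases Nat.eq_zero_or_pos M with h | h
    · rw [h]
      norm_num
    · have e : W ^ M = W ^ (M - 1) * W := by
        rw [← pow_succ]
        congr 1
        omega
      have h1 : (M : ℝ) ^ 2 ≤ 1 / 2 * W := by linarith
      calc (M : ℝ) ^ 2 * (2 ^ T * W ^ (M - 1)) ≤ 1 / 2 * W * (2 ^ T * W ^ (M - 1)) := by gcongr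
        _ = _ := by rw [e]; ring
  have hdesc : (K.descFactorial M : ℝ) * E ≤ (K : ℝ) ^ M * E := by
    gcongr
    exact_mod_cast Nat.descFactorial_le_pow K M
  have hsat : (2 : ℝ) ^ T * (2 ^ N * (K * b) ^ M) ≤
      (K : ℝ) ^ M * (2 * 2 ^ ((N : ℝ) * (2 + α * Real.logb 2 b))) := by
    have h1 : b ^ M ≤ 2 * b ^ (α * (N : ℝ)) := pow_floor_le_two_mul (by linarith)
      (by
        have : (0 : ℝ) < 1 / 2 ^ k := by positivity
        linarith)
    have h2 : (2 : ℝ) ^ ((N : ℝ) * (2 + α * Real.logb 2 b)) =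
        2 ^ N * (2 ^ N * b ^ (α * (N : ℝ))) := by
      rw [two_pow_mul_rpow (by omega) (by linarith), ← Real.rpow_natCast 2 N,
        ← Real.rpow_add two_pos]
      have : (N : ℝ) ≠ 0 := by positivity
      congr 1
      field_simp
      ring
    have h3 : (2 : ℝ) ^ T ≤ 2 ^ N := pow_le_pow_right₀ one_le_two hT
    rw [h2]
    calc (2 : ℝ) ^ T * (2 ^ N * (K * b) ^ M) ≤ 2 ^ N * (2 ^ N * (K * b) ^ M) := by gcongr
      _ = (K : ℝ) ^ M * (2 ^ N * (2 ^ N * b ^ M)) := by rw [mul_pow]; ring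
      _ ≤ (K : ℝ) ^ M * (2 ^ N * (2 ^ N * (2 * b ^ (α * (N : ℝ))))) := by gcongr
      _ = _ := by ring
  have hmain : 2 ^ T * W ^ M = (K : ℝ) ^ M * (2 ^ T * (W / K) ^ M) := by
    rw [div_pow]
    field_simp
  have h5 : (K : ℝ) ^ M * (1 / 2 * (2 ^ T * (W / K) ^ M)) ≤ (K : ℝ) ^ M *
      (E + 2 * 2 ^ ((N : ℝ) * (2 + α * Real.logb 2 b))) := by
    rw [mul_add]
    linarith
  refine le_trans ?_ (le_of_mul_le_mul_left h5 hKM)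
  calc 1 / (2 * A) * 2 ^ ((N : ℝ) * Omega (T / N) α k)
      ≤ 1 / (2 * A) * (A * (2 ^ T * (W / K) ^ M)) := by gcongr
    _ = _ := by field_simp

theorem eventually_mul_le_rpow (A : ℝ) {δ : ℝ} (hδ : 0 < δ) :
    ∀ᶠ N : ℕ in atTop, A * ((N : ℝ) + 1) ^ 2 ≤ 2 ^ ((N : ℝ) * δ) := by
  have h1 : (1 : ℝ) < 2 ^ δ := Real.one_lt_rpow one_lt_two hδ
  have h2 := tendsto_pow_const_div_const_pow_of_one_lt 2 h1
  have hA : (0 : ℝ) < 1 / (4 * |A| + 1) := by positivity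
  filter_upwards [h2.eventually_lt_const hA, eventually_ge_atTop 1] with N hN hN1
  have hN' : (1 : ℝ) ≤ N := by exact_mod_cast hN1
  have hpos : (0 : ℝ) < (2 ^ δ) ^ N := by positivity
  rw [div_lt_iff₀ hpos, one_div, inv_mul_eq_div, lt_div_iff₀ (by positivity)] at hN
  have e : (2 : ℝ) ^ ((N : ℝ) * δ) = (2 ^ δ) ^ N := by
    rw [mul_comm, Real.rpow_mul zero_le_two, Real.rpow_natCast]
  rw [e]
  calc A * ((N : ℝ) + 1) ^ 2 ≤ |A| * (N + N) ^ 2 := by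
        gcongr
        exact le_abs_self A
    _ ≤ (N : ℝ) ^ 2 * (4 * |A| + 1) := by nlinarith [sq_nonneg (N : ℝ), abs_nonneg A]
    _ ≤ _ := hN.le

theorem eventually_expectRandom_nodes_le (hk : 3 ≤ k) (hα : 0 < α) {δ : ℝ} (hδ : 0 < δ) :
    ∀ᶠ N : ℕ in atTop, ∀ rule : UnitRule N,
      expectRandom rule SearchTree.nodes k ⌊α * N⌋₊ ≤ 2 ^ ((N : ℝ) * (omegaC α k + δ)) := by
  obtain ⟨A, -, hev⟩ := exists_expectRandom_nodes_le hk hα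
  filter_upwards [hev, eventually_mul_le_rpow A hδ] with N h1 h2 rule
  refine (h1 rule).trans ?_
  rw [mul_add, Real.rpow_add two_pos, mul_comm ((2 : ℝ) ^ ((N : ℝ) * omegaC α k))]
  gcongr

theorem eventually_le_expectRandom_leaves (hk : 3 ≤ k) (hα : 0 < α)
    (hthr : 2 + α * Real.logb 2 (1 - 1 / 2 ^ k) < omegaC α k) {δ : ℝ} (hδ : 0 < δ) :
    ∀ᶠ N : ℕ in atTop, ∀ rule : UnitRule N,
      2 ^ ((N : ℝ) * (omegaC α k - δ)) ≤ expectRandom rule SearchTree.leaves k ⌊α * N⌋₊ := by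
  obtain ⟨A, hA, hev⟩ := exists_le_expectRandom_leaves hk hα
  obtain ⟨t, ht, hω, -⟩ := exists_omegaC_eq (k := k) (by omega) α
  set s := 2 + α * Real.logb 2 (1 - 1 / 2 ^ k)
  set ω := omegaC α k
  -- The level `⌊t N⌋` has exponent at least `ω - η`; both `δ - η` and `ω - η - s` are positive.
  set η := min (δ / 2) ((ω - s) / 2) with hη
  have hη0 : 0 < η := lt_min (by linarith) (by linarith)
  have hη1 : η ≤ δ / 2 := min_le_left _ _
  have hη2 : η ≤ (ω - s) / 2 := min_le_right _ _
  have hlim : Tendsto (fun N : ℕ => ((⌊t * (N : ℝ)⌋₊ : ℕ) : ℝ) / N) atTop (nhds t) :=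
    (tendsto_nat_floor_mul_div_atTop ht.1).comp tendsto_natCast_atTop_atTop
  have hmem : ∀ N : ℕ, ⌊t * (N : ℝ)⌋₊ ≤ N := fun N => by
    refine Nat.floor_le_of_le ?_
    nlinarith [ht.2, (Nat.cast_nonneg N : (0 : ℝ) ≤ N)]
  have hlim' : Tendsto (fun N : ℕ => ((⌊t * (N : ℝ)⌋₊ : ℕ) : ℝ) / N) atTop
      (nhdsWithin t (Set.Icc 0 1)) := by
    refine tendsto_nhdsWithin_iff.2 ⟨hlim, Eventually.of_forall fun N => ⟨by positivity, ?_⟩⟩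
    exact div_le_one_of_le₀ (by exact_mod_cast hmem N) (Nat.cast_nonneg N)
  have hOmega := ((continuousOn_Omega (k := k) (by omega) α) t ht).tendsto.comp hlim'
  have hevO : ∀ᶠ N : ℕ in atTop,
      ω - η < Omega (((⌊t * (N : ℝ)⌋₊ : ℕ) : ℝ) / N) α k :=
    hOmega.eventually_const_lt (by rw [hω]; linarith)
  filter_upwards [hev, hevO, eventually_mul_le_rpow (4 / A) (δ := (ω - s) / 2) (by linarith),
    eventually_mul_le_rpow (2 / A) (δ := δ / 2) (by linarith)] with N h1 h2 h3 h4 rule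
  have h5 := h1 rule _ (hmem N)
  have hN0 : (0 : ℝ) ≤ N := Nat.cast_nonneg N
  have hsq : (1 : ℝ) ≤ ((N : ℝ) + 1) ^ 2 := by nlinarith
  have h6 : (2 : ℝ) ^ ((N : ℝ) * (ω - η)) ≤
      2 ^ ((N : ℝ) * Omega (((⌊t * (N : ℝ)⌋₊ : ℕ) : ℝ) / N) α k) := by
    gcongr
    exact one_le_two
  have h7 : 4 / A * 2 ^ ((N : ℝ) * s) ≤ 2 ^ ((N : ℝ) * (ω - η)) := by
    calc 4 / A * (2 : ℝ) ^ ((N : ℝ) * s) ≤ 4 / A * ((N : ℝ) + 1) ^ 2 * 2 ^ ((N : ℝ) * s) := by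
          gcongr
          exact le_mul_of_one_le_right (by positivity) hsq
      _ ≤ 2 ^ ((N : ℝ) * ((ω - s) / 2)) * 2 ^ ((N : ℝ) * s) := by gcongr
      _ = 2 ^ ((N : ℝ) * ((ω - s) / 2 + s)) := by
          rw [← Real.rpow_add two_pos, ← mul_add]
      _ ≤ _ := by
          gcongr
          · exact one_le_two
          · linarith
  have h8 : 2 / A * 2 ^ ((N : ℝ) * (ω - δ)) ≤ 2 ^ ((N : ℝ) * (ω - η)) := by
    calc 2 / A * (2 : ℝ) ^ ((N : ℝ) * (ω - δ))
        ≤ 2 / A * ((N : ℝ) + 1) ^ 2 * 2 ^ ((N : ℝ) * (ω - δ)) := by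
          gcongr
          exact le_mul_of_one_le_right (by positivity) hsq
      _ ≤ 2 ^ ((N : ℝ) * (δ / 2)) * 2 ^ ((N : ℝ) * (ω - δ)) := by gcongr
      _ = 2 ^ ((N : ℝ) * (δ / 2 + (ω - δ))) := by
          rw [← Real.rpow_add two_pos, ← mul_add]
      _ ≤ _ := by
          gcongr
          · exact one_le_two
          · linarith
  have h9 := mul_le_mul_of_nonneg_left h6 hA.le
  rw [div_mul_eq_mul_div, div_le_iff₀ hA] at h7 h8
  linarith

theorem exists_isLittleO_of_bounds {E : ℕ → ℝ} {ω : ℝ}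
    (hE : ∀ δ : ℝ, 0 < δ → ∀ᶠ N : ℕ in atTop,
      2 ^ ((N : ℝ) * (ω - δ)) ≤ E N ∧ E N ≤ 2 ^ ((N : ℝ) * (ω + δ))) :
    ∃ ε : ℕ → ℝ, ε =o[atTop] (fun N : ℕ => (N : ℝ)) ∧
      ∀ᶠ N : ℕ in atTop, E N = (2 : ℝ) ^ ((N : ℝ) * ω + ε N) := by
  refine ⟨fun N => Real.logb 2 (E N) - N * ω, ?_, ?_⟩
  · rw [isLittleO_iff]
    intro δ hδ
    filter_upwards [hE δ hδ] with N hN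
    have hpos : 0 < E N := lt_of_lt_of_le (by positivity) hN.1
    have h1 := (Real.le_logb_iff_rpow_le one_lt_two hpos).2 hN.1
    have h2 := (Real.logb_le_iff_le_rpow one_lt_two hpos).2 hN.2
    rw [Real.norm_eq_abs, Real.norm_eq_abs, Nat.abs_cast, abs_le]
    constructor <;> linarith
  · filter_upwards [hE 1 one_pos] with N hN
    have hpos : 0 < E N := lt_of_lt_of_le (by positivity) hN.1
    rw [add_sub_cancel, Real.rpow_logb two_pos (by norm_num) hpos]

end asymptotics

end RandomSat

theorem corollary1 (k : ℕ) (hk : 3 ≤ k) :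
    ∃ αu : ℝ, 0 < αu ∧
      (∀ α : ℝ, RandomSat.omegaC α k = 2 + α * Real.logb 2 (1 - 1 / 2 ^ k) ↔ α = αu) ∧
      (k = 3 → 10.1286 ≤ αu ∧ αu < 10.1287) ∧
      ∀ α : ℝ, αu < α → ∀ rule : (N : ℕ) → RandomSat.UnitRule N,
        (∃ ε : ℕ → ℝ, ε =o[atTop] (fun N : ℕ => (N : ℝ)) ∧
          ∀ᶠ N : ℕ in atTop,
            RandomSat.expectRandom (rule N) RandomSat.SearchTree.leaves k ⌊α * N⌋₊ =
              (2 : ℝ) ^ ((N : ℝ) * RandomSat.omegaC α k + ε N)) ∧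
        (∃ ε : ℕ → ℝ, ε =o[atTop] (fun N : ℕ => (N : ℝ)) ∧
          ∀ᶠ N : ℕ in atTop,
            RandomSat.expectRandom (rule N) RandomSat.SearchTree.nodes k ⌊α * N⌋₊ =
              (2 : ℝ) ^ ((N : ℝ) * RandomSat.omegaC α k + ε N)) := by
  have hk2 : 2 ≤ k := by omega
  obtain ⟨αu, hpos, hαu⟩ := RandomSat.exists_threshold hk2
  refine ⟨αu, hpos, fun α => ⟨fun hα => ?_, fun h => h ▸ hαu⟩, ?_, fun α hα rule => ?_⟩
  · rcases lt_trichotomy α αu with h | h | h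
    · exact absurd hαu (RandomSat.lt_omegaC_of_eq hk2 h hα).ne'
    · exact h
    · exact absurd hα (RandomSat.lt_omegaC_of_eq hk2 h hαu).ne'
  · rintro rfl
    exact RandomSat.threshold_three hαu
  · have hα0 : 0 < α := hpos.trans hα
    have hthr := RandomSat.lt_omegaC_of_eq hk2 hα hαu
    refine ⟨RandomSat.exists_isLittleO_of_bounds fun δ hδ => ?_,
      RandomSat.exists_isLittleO_of_bounds fun δ hδ => ?_⟩
    all_goals
      filter_upwards [RandomSat.eventually_expectRandom_nodes_le hk hα0 hδ,
        RandomSat.eventually_le_expectRandom_leaves hk hα0 hthr hδ] with N h1 h2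
    · exact ⟨h2 (rule N), (RandomSat.expectRandom_leaves_le_nodes (rule N)).trans (h1 (rule N))⟩
    · exact ⟨(h2 (rule N)).trans (RandomSat.expectRandom_leaves_le_nodes (rule N)), h1 (rule N)⟩
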